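/- **Setting.** Let $(\Omega,\mathfrak F,\mathbb P)$ be a complete probability space and $(\theta_t)_{t\in\mathbb R}$ an ergodic metric dynamical system on it: $(t,\omega)\mapsto\theta_t\omega$ is $\mathfrak B(\mathbb R)\otimes\mathfrak F$-measurable, $\theta_0=\mathrm{id}$, $\theta_{s+t}=\theta_t\circ\theta_s$, each $\theta_t$ preserves $\mathbb P$, and every $F\in\mathfrak F$ with $\theta_t^{-1}F=F$ for all $t$ has $\mathbb P(F)\in\{0,1\}$. Let $N\ge 1$, $1<p<\infty$, $1/p+1/q=1$, and let $A,B:\Omega\to\mathbb R^{N\times N}$ satisfy (norms are Euclidean, resp. the induced operator norms): * (S1) $A$ and $B$ are measurable; * (S2) $\|A\|\in L_1(\mathbb P)$ and $\omega\mapsto\ln^+\int_0^1\|B(\theta_r\omega)\|^q\,dr$ is in $L_1(\mathbb P)$. The invariant set of those $\omega$ for which $t\mapsto\|A(\theta_t\omega)\|\in L_{1,\mathrm{loc}}(\mathbb R)$ and $t\mapsto\|B(\theta_t\omega)\|\in L_{q,\mathrm{loc}}(\mathbb R)$ has full measure; reset $A$ and $B$ to $0$ outside this set. Let $C=C([-1,0],\mathbb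 R^N)$ with the supremum norm, $L=\mathbb R^N\times L_p([-1,0],\mathbb R^N)$ with $\|(u_1,u_2)\|=\|u_1\|+\|u_2\|_p$, and $J:C\to L$, $Ju=(u(0),u)$. For $u=(u_1,u_2)\in L$ let $z(\cdot,\omega,u)$ be the Carathéodory solution of $$z'(t)=A(\theta_t\omega)z(t)+B(\theta_t\omega)z(t-1)\ (t\ge 0),\qquad z(0)=u_1,\quad z=u_2\text{ on }[-1,0),$$ that is, $z$ is continuous on $[0,\infty)$ and satisfies the integrated equation; for $u\in C$ take $z=u$ on $[-1,0]$. With $z_t(\omega,u)(s)=z(t+s,\omega,u)$, $s\in[-1,0]$, put $U^{(C)}_\omega(t)u=z_t(\omega,u)$ on $C$ and $U^{(L)}_\omega(t)u=(z(t,\omega,u),z_t(\omega,u))$ on $L$ for $t\ge0$, and $U^{(L,C)}_\omega(t)u=z_t(\omega,u)$ from $L$ to $C$ for $t\ge1$. Let $\Phi^{(C)}=((U^{(C)}_\omega(t)),(\theta_t))$ and $\Phi^{(L)}=((U^{(L)}_\omega(t)),(\theta_t))$. **Oseledets decompositions.** Let $((U_\omega(t)),(\theta_t))$ be a linear semiflow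 on a Banach space $X$. Put $\ln 0=-\infty$. A *negative semiorbit* through $(\omega,u)$ is a Borel map $\tilde u:(-\infty,0]\to X$ with $\tilde u(0)=u$ and $\tilde u(t+s)=U_{\theta_s\omega}(t)\tilde u(s)$ for $s\le0\le t$, $s+t\le0$. Over a measurable set $\Omega_0$, a family of finite-dimensional subspaces $E(\omega)$ is *measurable* if it has a basis consisting of a fixed number of measurable functions $\Omega_0\to X$. If $E(\omega)\oplus F(\omega)=X$ and $P(\omega)$ is the projection onto $F(\omega)$ along $E(\omega)$, the projections are *strongly measurable* if $\omega\mapsto P(\omega)u$ is measurable on $\Omega_0$ for each $u$, and *tempered* if $\lim_{t\to\pm\infty}\frac1t\ln\|P(\theta_t\omega)\|=0$ for a.e. $\omega\in\Omega_0$. An *Oseledets decomposition* consists of a measurable set $\Omega_0$ of probability one with $\theta_t^{-1}\Omega_0=\Omega_0$ for all $t$, a number $k\in\{1,2,\dots\}$ (case (I)) or $k=\infty$ (case (II)), real numbers $\lambda_1>\lambda_2>\cdots$ ($\lambda_i$ for $1\le i\le k$, resp. for all $i\in\mathbb N$, the *Lyapunov exponents*) with $\lim_{t\to\infty}\frac1t\ln\|U_\omega(t)\|=\lambda_1$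 for a.e. $\omega$ and, in case (II), $\lambda_i\to-\infty$, measurable families of finite-dimensional subspaces $E_i(\omega)$, and: * in case (I), closed finite-codimensional subspaces $F_\infty(\omega)$ with $E_1(\omega)\oplus\dots\oplus E_k(\omega)\oplus F_\infty(\omega)=X$; then $F_i(\omega):=\bigoplus_{j=i+1}^kE_j(\omega)\oplus F_\infty(\omega)$ for $0\le i\le k$, so that $F_0=X$ and $F_k=F_\infty$; * in case (II), closed finite-codimensional subspaces $F_i(\omega)$, $i\in\mathbb N$, with $E_1(\omega)\oplus\dots\oplus E_i(\omega)\oplus F_i(\omega)=X$ and $F_i(\omega)=E_{i+1}(\omega)\oplus F_{i+1}(\omega)$; then $F_0:=X$ and $F_\infty(\omega):=\bigcap_{j\ge1}F_j(\omega)$; such that for all $\omega\in\Omega_0$ and all indices $i$ with $1\le i\le k$ (resp. $i\in\mathbb N$): 1. for $t\ge0$, $U_\omega(t)E_i(\omega)=E_i(\theta_t\omega)$, and $U_\omega(t)F_\infty(\omega)\subset F_\infty(\theta_t\omega)$ in case (I), $U_\omega(t)F_i(\omega)\subset F_i(\theta_t\omega)$ in case (II); 2. the projections associated with $\bigl(\bigoplus_{j=1}^iE_j(\omega)\bigr)\oplus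 F_i(\omega)=X$ are strongly measurable and tempered; 3. $\lim_{t\to\infty}\frac1t\ln\|U_\omega(t)|_{E_i(\omega)}\|=\lambda_i$, and $\lim_{t\to\infty}\frac1t\ln\|U_\omega(t)u\|=\lambda_i$ for every nonzero $u\in E_i(\omega)$; 4. $\lim_{t\to\infty}\frac1t\ln\|U_\omega(t)u\|=\lambda_i$ for every $u\in F_{i-1}(\omega)\setminus F_i(\omega)$; 5. a nonzero $u\in F_{i-1}(\omega)$ belongs to $E_i(\omega)$ if and only if there is a negative semiorbit $\tilde u$ through $(\omega,u)$ with $\lim_{s\to-\infty}\frac1s\ln\|\tilde u(s)\|=\lambda_i$; 6. in case (I), $\lim_{t\to\infty}\frac1t\ln\|U_\omega(t)|_{F_\infty(\omega)}\|=-\infty$; in case (II), $\lim_{t\to\infty}\frac1t\ln\|U_\omega(t)|_{F_i(\omega)}\|=\lambda_{i+1}$, and $\lim_{t\to\infty}\frac1t\ln\|U_\omega(t)u\|=-\infty$ for every nonzero $u\in F_\infty(\omega)$. **Theorem.** Assume that $\Phi^{(C)}$ and $\Phi^{(L)}$ both admit Oseledets decompositions, with data marked by superscripts $(C)$ and $(L)$.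 Then the two decompositions are in the same case, with the same number $k$ of exponents in case (I). For every $i\in\{1,\dots,k\}$ in case (I), and every $i\in\mathbb N$ in case (II): * (a) $\lambda_i^{(C)}=\lambda_i^{(L)}$; * (b) $F_i^{(C)}(\omega)=J^{-1}(F_i^{(L)}(\omega))$ for $\mathbb P$-a.e. $\omega$; * (c) for $\mathbb P$-a.e. $\omega$, $U^{(L,C)}_\omega(t)F_i^{(L)}(\omega)\subset F_i^{(C)}(\theta_t\omega)$ for all $t\ge1$. Moreover, * (d) $F_\infty^{(C)}(\omega)=J^{-1}(F_\infty^{(L)}(\omega))$ for $\mathbb P$-a.e. $\omega$; * (e) for $\mathbb P$-a.e. $\omega$, $U^{(L,C)}_\omega(t)F_\infty^{(L)}(\omega)\subset F_\infty^{(C)}(\theta_t\omega)$ for all $t\ge1$. -/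

import Mathlib

open MeasureTheory Filter Topology

noncomputable section

/-! ## Metric dynamical systems -/

/-- An ergodic metric dynamical system `(θ_t)` (with two-sided continuous time) on a probability
space `(Ω, 𝔉, P)`. -/
structure IsErgodicMDS {Ω : Type*} [MeasurableSpace Ω] (P : Measure Ω) (θ : ℝ → Ω → Ω) :
    Prop where
  measurable : Measurable (fun x : ℝ × Ω => θ x.1 x.2)
  zero : ∀ ω, θ 0 ω = ω
  add : ∀ s t ω, θ (s + t) ω = θ t (θ s ω)
  preserving : ∀ t, MeasurePreserving (θ t) P P
  ergodic : ∀ S : Set Ω, MeasurableSet S → (∀ t, θ t ⁻¹' S = S) → P S = 0 ∨ P S = 1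

/-! ## Oseledets decompositions

Throughout, `U t ω` (for `t ≥ 0`) is the bounded operator `U_ω(t)` on the Banach space `X`. -/

/-- `ln x / t` as an extended real number, with `ln 0 = -∞` (used for `x ≥ 0` and `t ≠ 0`). -/
def logRate (x t : ℝ) : EReal := ENNReal.log (ENNReal.ofReal x) / (t : EReal)

/-- A measurable family of finite-dimensional subspaces over `Ω₀`: for some `l` there are measurable
`v₁, …, v_l : Ω₀ → X` such that `v₁(ω), …, v_l(ω)` is a basis of `E(ω)` for all `ω ∈ Ω₀`. -/
def IsMeasurableFamily {Ω X : Type*} [MeasurableSpace Ω] [NormedAddCommGroup X] [NormedSpace ℝ X]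
    (Ω₀ : Set Ω) (E : Ω → Submodule ℝ X) : Prop :=
  ∃ (l : ℕ) (v : Fin l → Ω₀ → X),
    (∀ j, @Measurable Ω₀ X _ (borel X) (v j)) ∧
    ∀ ω : Ω₀, LinearIndependent ℝ (fun j => v j ω) ∧
      Submodule.span ℝ (Set.range fun j => v j ω) = E ω

/-- `E₁ ⊕ ⋯ ⊕ E_n ⊕ F = X`. -/
def IsDirectSum {X : Type*} [NormedAddCommGroup X] [NormedSpace ℝ X]
    (n : ℕ) (E : ℕ → Submodule ℝ X) (F : Submodule ℝ X) : Prop :=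
  DirectSum.IsInternal (fun o : Option (Fin n) => o.elim F (fun j => E (j.val + 1)))

/-- The family of projections onto `F(ω)` along `E(ω)`, where `E(ω) ⊕ F(ω) = X` for `ω ∈ Ω₀`, is
strongly measurable and tempered. -/
def IsTemperedSplitting {Ω X : Type*} [MeasurableSpace Ω] [NormedAddCommGroup X] [NormedSpace ℝ X]
    (P : Measure Ω) (θ : ℝ → Ω → Ω) (Ω₀ : Set Ω) (E F : Ω → Submodule ℝ X) : Prop :=
  ∃ Q : Ω → X →L[ℝ] X,
    (∀ ω ∈ Ω₀, (∀ e ∈ E ω, Q ω e = 0) ∧ (∀ f ∈ F ω, Q ω f = f)) ∧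
    (∀ u : X, @Measurable Ω₀ X _ (borel X) (fun ω : Ω₀ => Q ω u)) ∧
    ∀ᵐ ω ∂P, ω ∈ Ω₀ →
      Tendsto (fun t : ℝ => logRate ‖Q (θ t ω)‖ t) atTop (𝓝 0) ∧
      Tendsto (fun t : ℝ => logRate ‖Q (θ t ω)‖ t) atBot (𝓝 0)

/-- `v` (restricted to `(-∞, 0]`) is a negative semiorbit passing through `(ω, u)`. -/
structure IsNegSemiorbit {Ω X : Type*} [NormedAddCommGroup X] [NormedSpace ℝ X]
    (θ : ℝ → Ω → Ω) (U : ℝ → Ω → X →L[ℝ] X) (ω : Ω) (u : X) (v : ℝ → X) : Prop where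
  measurable : @Measurable (Set.Iic (0 : ℝ)) X _ (borel X) (fun s : Set.Iic (0 : ℝ) => v s)
  zero : v 0 = u
  orbit : ∀ s t : ℝ, s ≤ 0 → 0 ≤ t → s + t ≤ 0 → v (t + s) = U t (θ s ω) (v s)

/-- The data of an Oseledets decomposition. The number `k` of Lyapunov exponents is a natural number
(case (I)) or `⊤` (case (II)); `lam i` is the `i`-th Lyapunov exponent and `E i ω` the `i`-th
Oseledets subspace, both meaningful for `1 ≤ i ≤ k`; `F i ω` is the `i`-th member of the
filtration, meaningful for `0 ≤ i ≤ k`, with `F 0 = X` and, in case (I), `F k = F_∞`;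
`Finf ω` is `F_∞(ω)`. The families matter over the set `Ω₀` only. -/
structure OseledetsData (Ω X : Type*) [NormedAddCommGroup X] [NormedSpace ℝ X] where
  k : ℕ∞
  Ω₀ : Set Ω
  lam : ℕ → ℝ
  E : ℕ → Ω → Submodule ℝ X
  F : ℕ → Ω → Submodule ℝ X
  Finf : Ω → Submodule ℝ X

/-- Case (I) of an Oseledets decomposition: finitely many Lyapunov exponents
`λ₁ = λ_top > ⋯ > λ_k`. -/
structure OseledetsCaseI {Ω X : Type*} [MeasurableSpace Ω] [NormedAddCommGroup X]
    [NormedSpace ℝ X] (P : Measure Ω) (θ : ℝ → Ω → Ω) (U : ℝ → Ω → X →L[ℝ] X)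
    (D : OseledetsData Ω X) (k : ℕ) : Prop where
  one_le : 1 ≤ k
  lam_lt : ∀ i j, 1 ≤ i → i < j → j ≤ k → D.lam j < D.lam i
  /-- `λ₁` is the top Lyapunov exponent. -/
  lam_top : ∀ᵐ ω ∂P, Tendsto (fun t : ℝ => logRate ‖U t ω‖ t) atTop (𝓝 (D.lam 1 : EReal))
  meas_E : ∀ i, 1 ≤ i → i ≤ k → IsMeasurableFamily D.Ω₀ (D.E i)
  closed_Finf : ∀ ω ∈ D.Ω₀, IsClosed (D.Finf ω : Set X)
  codim_Finf : ∀ ω ∈ D.Ω₀, FiniteDimensional ℝ (X ⧸ D.Finf ω)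
  map_E : ∀ i, 1 ≤ i → i ≤ k → ∀ ω ∈ D.Ω₀, ∀ t : ℝ, 0 ≤ t →
    (D.E i ω).map (U t ω).toLinearMap = D.E i (θ t ω)
  map_Finf : ∀ ω ∈ D.Ω₀, ∀ t : ℝ, 0 ≤ t →
    (D.Finf ω).map (U t ω).toLinearMap ≤ D.Finf (θ t ω)
  directSum : ∀ ω ∈ D.Ω₀, IsDirectSum k (fun i => D.E i ω) (D.Finf ω)
  /-- `F_i = E_{i+1} ⊕ ⋯ ⊕ E_k ⊕ F_∞`; this is `X` for `i = 0` and `F_∞` for `i = k`. -/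
  F_eq : ∀ i ≤ k, ∀ ω ∈ D.Ω₀, D.F i ω = (⨆ j ∈ Finset.Icc (i + 1) k, D.E j ω) ⊔ D.Finf ω
  tempered : ∀ i, 1 ≤ i → i ≤ k →
    IsTemperedSplitting P θ D.Ω₀ (fun ω => ⨆ j ∈ Finset.Icc 1 i, D.E j ω) (D.F i)
  rate_E_norm : ∀ i, 1 ≤ i → i ≤ k → ∀ ω ∈ D.Ω₀,
    Tendsto (fun t : ℝ => logRate ‖(U t ω).comp (D.E i ω).subtypeL‖ t) atTop
      (𝓝 (D.lam i : EReal))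
  rate_E : ∀ i, 1 ≤ i → i ≤ k → ∀ ω ∈ D.Ω₀, ∀ u ∈ D.E i ω, u ≠ 0 →
    Tendsto (fun t : ℝ => logRate ‖U t ω u‖ t) atTop (𝓝 (D.lam i : EReal))
  rate_F : ∀ i, 1 ≤ i → i ≤ k → ∀ ω ∈ D.Ω₀, ∀ u ∈ D.F (i - 1) ω, u ∉ D.F i ω →
    Tendsto (fun t : ℝ => logRate ‖U t ω u‖ t) atTop (𝓝 (D.lam i : EReal))
  mem_E_iff : ∀ i, 1 ≤ i → i ≤ k → ∀ ω ∈ D.Ω₀, ∀ u ∈ D.F (i - 1) ω, u ≠ 0 →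
    (u ∈ D.E i ω ↔ ∃ v : ℝ → X, IsNegSemiorbit θ U ω u v ∧
      Tendsto (fun s : ℝ => logRate ‖v s‖ s) atBot (𝓝 (D.lam i : EReal)))
  rate_Finf : ∀ ω ∈ D.Ω₀,
    Tendsto (fun t : ℝ => logRate ‖(U t ω).comp (D.Finf ω).subtypeL‖ t) atTop (𝓝 ⊥)

/-- Case (II) of an Oseledets decomposition: infinitely many Lyapunov exponents
`λ₁ = λ_top > λ₂ > ⋯` tending to `-∞`. -/
structure OseledetsCaseII {Ω X : Type*} [MeasurableSpace Ω] [NormedAddCommGroup X]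
    [NormedSpace ℝ X] (P : Measure Ω) (θ : ℝ → Ω → Ω) (U : ℝ → Ω → X →L[ℝ] X)
    (D : OseledetsData Ω X) : Prop where
  lam_lt : ∀ i j, 1 ≤ i → i < j → D.lam j < D.lam i
  lam_tendsto : Tendsto D.lam atTop atBot
  /-- `λ₁` is the top Lyapunov exponent. -/
  lam_top : ∀ᵐ ω ∂P, Tendsto (fun t : ℝ => logRate ‖U t ω‖ t) atTop (𝓝 (D.lam 1 : EReal))
  meas_E : ∀ i, 1 ≤ i → IsMeasurableFamily D.Ω₀ (D.E i)
  F_zero : ∀ ω ∈ D.Ω₀, D.F 0 ω = ⊤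
  closed_F : ∀ i, 1 ≤ i → ∀ ω ∈ D.Ω₀, IsClosed (D.F i ω : Set X)
  codim_F : ∀ i, 1 ≤ i → ∀ ω ∈ D.Ω₀, FiniteDimensional ℝ (X ⧸ D.F i ω)
  map_E : ∀ i, 1 ≤ i → ∀ ω ∈ D.Ω₀, ∀ t : ℝ, 0 ≤ t →
    (D.E i ω).map (U t ω).toLinearMap = D.E i (θ t ω)
  map_F : ∀ i, 1 ≤ i → ∀ ω ∈ D.Ω₀, ∀ t : ℝ, 0 ≤ t →
    (D.F i ω).map (U t ω).toLinearMap ≤ D.F i (θ t ω)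
  directSum : ∀ i, 1 ≤ i → ∀ ω ∈ D.Ω₀, IsDirectSum i (fun j => D.E j ω) (D.F i ω)
  /-- `F_i = E_{i+1} ⊕ F_{i+1}`. -/
  F_eq : ∀ i, 1 ≤ i → ∀ ω ∈ D.Ω₀, Disjoint (D.E (i + 1) ω) (D.F (i + 1) ω) ∧
    D.F i ω = D.E (i + 1) ω ⊔ D.F (i + 1) ω
  tempered : ∀ i, 1 ≤ i →
    IsTemperedSplitting P θ D.Ω₀ (fun ω => ⨆ j ∈ Finset.Icc 1 i, D.E j ω) (D.F i)
  rate_E_norm : ∀ i, 1 ≤ i → ∀ ω ∈ D.Ω₀,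
    Tendsto (fun t : ℝ => logRate ‖(U t ω).comp (D.E i ω).subtypeL‖ t) atTop
      (𝓝 (D.lam i : EReal))
  rate_E : ∀ i, 1 ≤ i → ∀ ω ∈ D.Ω₀, ∀ u ∈ D.E i ω, u ≠ 0 →
    Tendsto (fun t : ℝ => logRate ‖U t ω u‖ t) atTop (𝓝 (D.lam i : EReal))
  rate_F : ∀ i, 1 ≤ i → ∀ ω ∈ D.Ω₀, ∀ u ∈ D.F (i - 1) ω, u ∉ D.F i ω →
    Tendsto (fun t : ℝ => logRate ‖U t ω u‖ t) atTop (𝓝 (D.lam i : EReal))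
  mem_E_iff : ∀ i, 1 ≤ i → ∀ ω ∈ D.Ω₀, ∀ u ∈ D.F (i - 1) ω, u ≠ 0 →
    (u ∈ D.E i ω ↔ ∃ v : ℝ → X, IsNegSemiorbit θ U ω u v ∧
      Tendsto (fun s : ℝ => logRate ‖v s‖ s) atBot (𝓝 (D.lam i : EReal)))
  rate_F_norm : ∀ i, 1 ≤ i → ∀ ω ∈ D.Ω₀,
    Tendsto (fun t : ℝ => logRate ‖(U t ω).comp (D.F i ω).subtypeL‖ t) atTop
      (𝓝 (D.lam (i + 1) : EReal))
  Finf_eq : ∀ ω ∈ D.Ω₀, D.Finf ω = ⨅ i : ℕ, D.F (i + 1) ω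
  rate_Finf : ∀ ω ∈ D.Ω₀, ∀ u ∈ D.Finf ω, u ≠ 0 →
    Tendsto (fun t : ℝ => logRate ‖U t ω u‖ t) atTop (𝓝 ⊥)

/-- An Oseledets decomposition of the linear skew-product semiflow `((U_ω(t)), (θ_t))` on `X`. -/
structure OseledetsDecomposition {Ω X : Type*} [MeasurableSpace Ω] [NormedAddCommGroup X]
    [NormedSpace ℝ X] (P : Measure Ω) (θ : ℝ → Ω → Ω) (U : ℝ → Ω → X →L[ℝ] X)
    extends OseledetsData Ω X where
  measurableSet : MeasurableSet Ω₀
  prob_eq_one : P Ω₀ = 1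
  invariant : ∀ t : ℝ, θ t ⁻¹' Ω₀ = Ω₀
  cases : (∃ n : ℕ, k = n ∧ OseledetsCaseI P θ U toOseledetsData n) ∨
    (k = ⊤ ∧ OseledetsCaseII P θ U toOseledetsData)

/-! ## Linear random delay differential equations -/

/-- `ℝ^N` with the Euclidean norm. -/
abbrev EucN (N : ℕ) : Type := EuclideanSpace ℝ (Fin N)

/-- The delay interval `[-1, 0]`. -/
abbrev DelayIcc : Type := Set.Icc (-1 : ℝ) 0

/-- Lebesgue measure on `[-1, 0]`. -/
def delayVol : Measure DelayIcc := Measure.comap Subtype.val (volume : Measure ℝ)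

instance : IsFiniteMeasure delayVol := by
  constructor
  rw [delayVol, comap_subtype_coe_apply measurableSet_Icc]
  simp only [Set.image_univ, Subtype.range_coe]
  exact measure_Icc_lt_top

/-- The point `0 ∈ [-1, 0]`. -/
def DelayIcc.zero : DelayIcc := ⟨0, by norm_num⟩

/-- `C = C([-1, 0], ℝ^N)` with the supremum norm. -/
abbrev SpaceC (N : ℕ) : Type := C(DelayIcc, EucN N)

/-- `L = ℝ^N × L_p([-1, 0], ℝ^N)` with the norm `‖u₁‖ + ‖u₂‖_p`. -/
abbrev SpaceL (N : ℕ) (p : ENNReal) : Type :=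
  WithLp 1 (EucN N × Lp (EucN N) p delayVol)

/-- The embedding `J : C → L`, `J u = (u(0), u)`. -/
def embJ (N : ℕ) (p : ENNReal) [Fact (1 ≤ p)] : SpaceC N →L[ℝ] SpaceL N p :=
  (WithLp.prodContinuousLinearEquiv 1 ℝ (EucN N)
      (Lp (EucN N) p delayVol)).symm.toContinuousLinearMap.comp
    ((ContinuousMap.evalCLM ℝ DelayIcc.zero).prod
      (ContinuousMap.toLp p delayVol ℝ))

/-- The operator of a matrix on Euclidean space; its norm is the induced operator norm. -/
abbrev matOp {N : ℕ} (M : Matrix (Fin N) (Fin N) ℝ) : EucN N →L[ℝ] EucN N :=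
  Matrix.toEuclideanCLM (n := Fin N) (𝕜 := ℝ) M

/-- The invariant set of those `ω` for which `t ↦ ‖A(θ_t ω)‖` is in `L_{1,loc}(ℝ)` and
`t ↦ ‖B(θ_t ω)‖` is in `L_{q,loc}(ℝ)`. -/
def regularSet {Ω : Type*} {N : ℕ} (θ : ℝ → Ω → Ω) (A B : Ω → Matrix (Fin N) (Fin N) ℝ) (q : ℝ) :
    Set Ω :=
  {ω | LocallyIntegrable (fun t : ℝ => ‖matOp (A (θ t ω))‖) ∧
    LocallyIntegrable (fun t : ℝ => ‖matOp (B (θ t ω))‖ ^ q)}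

open Classical in
/-- The coefficient `M` reset to `0` outside the set `S` (applied with `S` the regular set, which has
full measure, so that all the delay equations are solvable). -/
def resetCoeff {Ω : Type*} {N : ℕ} (S : Set Ω) (M : Ω → Matrix (Fin N) (Fin N) ℝ) :
    Ω → Matrix (Fin N) (Fin N) ℝ :=
  fun ω => if ω ∈ S then M ω else 0

/-- `z : [-1, ∞) → ℝ^N` is the Carathéodory solution of
`z'(t) = A(θ_t ω) z(t) + B(θ_t ω) z(t - 1)`, `t ≥ 0`, with `z(0) = x` and `z = φ` on `[-1, 0)`. -/
structure IsDelaySolution {Ω : Type*} {N : ℕ} (θ : ℝ → Ω → Ω)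
    (A B : Ω → Matrix (Fin N) (Fin N) ℝ) (ω : Ω) (x : EucN N) (φ : DelayIcc → EucN N)
    (z : ℝ → EucN N) : Prop where
  init : z 0 = x
  history : ∀ s : DelayIcc, (s : ℝ) < 0 → z s = φ s
  continuousOn : ContinuousOn z (Set.Ici 0)
  integrable : ∀ t : ℝ, 0 ≤ t → IntervalIntegrable
    (fun s : ℝ => matOp (A (θ s ω)) (z s) + matOp (B (θ s ω)) (z (s - 1))) volume 0 t
  eq : ∀ t : ℝ, 0 ≤ t →
    z t = x + ∫ s in (0 : ℝ)..t, (matOp (A (θ s ω)) (z s) + matOp (B (θ s ω)) (z (s - 1)))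

/-- `T` is the time-`t` solution operator `u ↦ z_t(ω, u)` on `C`, where `z_t(s) = z(t + s)`. -/
def IsSolOpC {Ω : Type*} {N : ℕ} (θ : ℝ → Ω → Ω) (A B : Ω → Matrix (Fin N) (Fin N) ℝ)
    (t : ℝ) (ω : Ω) (T : SpaceC N →L[ℝ] SpaceC N) : Prop :=
  ∀ u : SpaceC N, ∃ z : ℝ → EucN N, IsDelaySolution θ A B ω (u DelayIcc.zero) u z ∧
    ∀ s : DelayIcc, T u s = z (t + s)

/-- `T` is the time-`t` solution operator `u ↦ (z(t, ω, u), z_t(ω, u))` on `L`. -/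
def IsSolOpL {Ω : Type*} {N : ℕ} (p : ENNReal) [Fact (1 ≤ p)] (θ : ℝ → Ω → Ω)
    (A B : Ω → Matrix (Fin N) (Fin N) ℝ) (t : ℝ) (ω : Ω)
    (T : SpaceL N p →L[ℝ] SpaceL N p) : Prop :=
  ∀ u : SpaceL N p, ∃ z : ℝ → EucN N, IsDelaySolution θ A B ω u.fst u.snd z ∧
    (T u).fst = z t ∧ (T u).snd =ᵐ[delayVol] fun s : DelayIcc => z (t + s)

/-- `T` is the operator `u ↦ z_t(ω, u)` from `L` to `C` (for `t ≥ 1`). -/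
def IsSolOpLC {Ω : Type*} {N : ℕ} (p : ENNReal) [Fact (1 ≤ p)] (θ : ℝ → Ω → Ω)
    (A B : Ω → Matrix (Fin N) (Fin N) ℝ) (t : ℝ) (ω : Ω)
    (T : SpaceL N p →L[ℝ] SpaceC N) : Prop :=
  ∀ u : SpaceL N p, ∃ z : ℝ → EucN N, IsDelaySolution θ A B ω u.fst u.snd z ∧
    ∀ s : DelayIcc, T u s = z (t + s)

open Classical in
/-- The semiflow `U^{(C)}_ω(t)` on `C` generated by the delay system (`t ≥ 0`). -/
def semiflowC {Ω : Type*} {N : ℕ} (θ : ℝ → Ω → Ω) (A B : Ω → Matrix (Fin N) (Fin N) ℝ)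
    (t : ℝ) (ω : Ω) : SpaceC N →L[ℝ] SpaceC N :=
  if h : ∃ T, IsSolOpC θ A B t ω T then h.choose else 0

open Classical in
/-- The semiflow `U^{(L)}_ω(t)` on `L` generated by the delay system (`t ≥ 0`). -/
def semiflowL {Ω : Type*} {N : ℕ} (p : ENNReal) [Fact (1 ≤ p)] (θ : ℝ → Ω → Ω)
    (A B : Ω → Matrix (Fin N) (Fin N) ℝ) (t : ℝ) (ω : Ω) : SpaceL N p →L[ℝ] SpaceL N p :=
  if h : ∃ T, IsSolOpL p θ A B t ω T then h.choose else 0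

open Classical in
/-- The operator `U^{(L,C)}_ω(t)` from `L` to `C` generated by the delay system (`t ≥ 1`). -/
def semiflowLC {Ω : Type*} {N : ℕ} (p : ENNReal) [Fact (1 ≤ p)] (θ : ℝ → Ω → Ω)
    (A B : Ω → Matrix (Fin N) (Fin N) ℝ) (t : ℝ) (ω : Ω) : SpaceL N p →L[ℝ] SpaceC N :=
  if h : ∃ T, IsSolOpLC p θ A B t ω T then h.choose else 0

/-- Measurability of the coefficients. -/
structure CondS1 {Ω : Type*} [MeasurableSpace Ω] {N : ℕ}
    (A B : Ω → Matrix (Fin N) (Fin N) ℝ) : Prop where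
  measurable_A : ∀ i j, Measurable (fun ω => A ω i j)
  measurable_B : ∀ i j, Measurable (fun ω => B ω i j)

/-- Summability of the coefficients: `‖A‖ ∈ L₁(P)` and `ln⁺ ∫₀¹ ‖B(θ_r ω)‖^q dr ∈ L₁(P)` (so that,
in particular, the inner integral is finite almost surely). -/
structure CondS2 {Ω : Type*} [MeasurableSpace Ω] (P : Measure Ω) {N : ℕ} (θ : ℝ → Ω → Ω)
    (A B : Ω → Matrix (Fin N) (Fin N) ℝ) (q : ℝ) : Prop where
  integrable_A : Integrable (fun ω => ‖matOp (A ω)‖) P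
  finite_B : ∀ᵐ ω ∂P, ∫⁻ r in Set.Icc (0 : ℝ) 1, ‖matOp (B (θ r ω))‖ₑ ^ q < ⊤
  integrable_B : Integrable
    (fun ω => Real.posLog (∫⁻ r in Set.Icc (0 : ℝ) 1, ‖matOp (B (θ r ω))‖ₑ ^ q).toReal) P

end

/-!
The members of both filtrations can be read off from growth rates. Over `Ω₀` every vector `u` has a
rate `r = lim (1/t) ln ‖U_ω(t) u‖`, which is `-∞` or one of the Lyapunov exponents; each exponent
occurs, `u ∈ F_i(ω)` holds exactly if `r < λ_i`, and `u ∈ F_∞(ω)` exactly if `r = -∞`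
(`OseledetsDecomposition.exists_hasRate`). So everything follows once growth rates in `C` and in `L`
are compared.

Since `J U^{(C)}_ω(t) = U^{(L)}_ω(t) J` and `J` is bounded, the rate of `J u` is at most that of `u`.
Conversely, Gronwall's and Hölder's inequalities bound the supremum norm of a solution over
`[s, s + 1]` by its norm in `L` at time `s`, with a constant depending only on the integrals of `‖A‖`
and `‖B‖ ^ q` over that interval (`norm_isSolOpC_le`). By Poincaré recurrence for `θ_1` these
integrals stay bounded along a sequence `s → ∞` for almost every `ω` (`ae_isRecurrent`). As both
rates are limits, a bound along a sequence is enough, and the rates agree (`rate_eq_rate_embJ`); no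
temperedness of the smoothing constants is needed. Through `J U^{(L,C)}_ω(t) = U^{(L)}_ω(t)` and the
cocycle property, `U^{(L,C)}_ω(t) v` has over `θ_t ω` the rate of `v` over `ω`
(`IsComparable.hasRate_semiflowLC`). Hence the two semiflows have the same finite rates, which gives
equal exponents, and the statements on the filtrations are translations of inequalities between
rates.

The solution operators on `C` and `L` enter as a choice with default value `0`. The decompositions
exclude the default over `Ω₀`: `U_ω(t)` maps `E_1(ω) ≠ 0` onto `E_1(θ_t ω) ≠ 0`, so that it does not
vanish and is the genuine solution operator (`OseledetsDecomposition.semiflow_ne_zero`). The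
operators from `L` to `C` are obtained from those on `L` by the closed graph theorem.
-/

/-! ### Exponential rates -/

lemma logRate_lt_coe_iff {x t c : ℝ} (ht : 0 < t) :
    logRate x t < (c : EReal) ↔ x < Real.exp (c * t) := by
  rw [logRate, EReal.div_lt_iff (by exact_mod_cast ht) (EReal.coe_ne_top t), ← EReal.coe_mul,
    ← EReal.log_exp ((c * t : ℝ) : EReal), ENNReal.log_lt_log_iff, EReal.exp_coe,
    ENNReal.ofReal_lt_ofReal_iff (Real.exp_pos _)]

lemma coe_lt_logRate_iff {x t c : ℝ} (ht : 0 < t) :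
    (c : EReal) < logRate x t ↔ Real.exp (c * t) < x := by
  rw [logRate, EReal.lt_div_iff (by exact_mod_cast ht) (EReal.coe_ne_top t), ← EReal.coe_mul,
    ← EReal.log_exp ((c * t : ℝ) : EReal), ENNReal.log_lt_log_iff, EReal.exp_coe]
  rcases lt_or_ge 0 x with hx | hx
  · rw [ENNReal.ofReal_lt_ofReal_iff hx]
  · rw [ENNReal.ofReal_of_nonpos hx]
    exact ⟨fun h => absurd h (by simp), fun h => absurd (h.trans_le hx) (Real.exp_pos _).not_gt⟩

lemma tendsto_logRate_bot_iff {x : ℝ → ℝ} :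
    Tendsto (fun t => logRate (x t) t) atTop (𝓝 ⊥) ↔
      ∀ c : ℝ, ∀ᶠ t in atTop, x t < Real.exp (c * t) := by
  rw [EReal.tendsto_nhds_bot_iff_real]
  refine forall_congr' fun c => eventually_congr ?_
  filter_upwards [eventually_gt_atTop 0] with t ht using logRate_lt_coe_iff ht

/-- A bound `x (t + τ) ≤ K y t` along some sequence `t → ∞` suffices to compare two rates that are
known to exist as limits. -/
lemma rate_le_of_frequently {x y : ℝ → ℝ} {a b : EReal} {K : ℝ} (τ : ℝ) (hK : 0 ≤ K)
    (hx : Tendsto (fun t => logRate (x t) t) atTop (𝓝 a))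
    (hy : Tendsto (fun t => logRate (y t) t) atTop (𝓝 b))
    (hxy : ∃ᶠ t in atTop, x (t + τ) ≤ K * y t) : a ≤ b := by
  by_contra! hab
  obtain ⟨c, hbc, hca⟩ := EReal.lt_iff_exists_real_btwn.1 hab
  obtain ⟨d, hcd, hda⟩ := EReal.lt_iff_exists_real_btwn.1 hca
  have hcd' : c < d := by exact_mod_cast hcd
  have h1 : ∀ᶠ t in atTop, Real.exp (d * (t + τ)) < x (t + τ) := by
    have h := (hx.eventually (lt_mem_nhds hda)).and (eventually_gt_atTop 0)
    filter_upwards [(tendsto_atTop_add_const_right atTop τ tendsto_id).eventually h] with t ht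
    exact (coe_lt_logRate_iff ht.2).1 ht.1
  have h2 : ∀ᶠ t in atTop, y t < Real.exp (c * t) := by
    filter_upwards [hy.eventually (gt_mem_nhds hbc), eventually_gt_atTop 0] with t ht h0
    exact (logRate_lt_coe_iff h0).1 ht
  have h3 : ∀ᶠ t in atTop, K < Real.exp (d * τ + (d - c) * t) := by
    have : Tendsto (fun t : ℝ => d * τ + (d - c) * t) atTop atTop :=
      tendsto_atTop_add_const_left _ _ (tendsto_id.const_mul_atTop (sub_pos.2 hcd'))
    exact (Real.tendsto_exp_atTop.comp this).eventually_gt_atTop K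
  obtain ⟨t, ht, h1, h2, h3⟩ := (hxy.and_eventually (h1.and (h2.and h3))).exists
  have : Real.exp (d * (t + τ)) = Real.exp (d * τ + (d - c) * t) * Real.exp (c * t) := by
    rw [← Real.exp_add]; congr 1; ring
  nlinarith [Real.exp_pos (c * t), mul_le_mul_of_nonneg_left h2.le hK,
    mul_lt_mul_of_pos_right h3 (Real.exp_pos (c * t))]

lemma tendsto_logRate_bot_of_le {x y : ℝ → ℝ} {K : ℝ} (hK : 0 ≤ K)
    (hy : Tendsto (fun t => logRate (y t) t) atTop (𝓝 ⊥)) (hxy : ∀ t, x t ≤ y t * K) :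
    Tendsto (fun t => logRate (x t) t) atTop (𝓝 ⊥) := by
  rw [tendsto_logRate_bot_iff] at hy ⊢
  intro c
  filter_upwards [hy (c - 1), Real.tendsto_exp_atTop.eventually_gt_atTop K] with t ht hKt
  have : Real.exp (c * t) = Real.exp ((c - 1) * t) * Real.exp t := by
    rw [← Real.exp_add]; congr 1; ring
  rw [this]
  exact (hxy t).trans_lt ((mul_le_mul_of_nonneg_right ht.le hK).trans_lt
    (mul_lt_mul_of_pos_left hKt (Real.exp_pos _)))

/-! ### Strictly decreasing sequences with the same values -/

/-- The induction step for `eq_of_values_eq`, one inequality at a time: the index `j` at which the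
second sequence takes the value `lam i` is not below `i`, where the sequences already agree. -/
lemma le_of_values_subset {k k' : ℕ∞} {lam lam' : ℕ → ℝ}
    (h : ∀ i j : ℕ, 1 ≤ i → i < j → (j : ℕ∞) ≤ k → lam j < lam i)
    (h' : ∀ i j : ℕ, 1 ≤ i → i < j → (j : ℕ∞) ≤ k' → lam' j < lam' i)
    (hsub : ∀ i : ℕ, 1 ≤ i → (i : ℕ∞) ≤ k → ∃ j : ℕ, 1 ≤ j ∧ (j : ℕ∞) ≤ k' ∧ lam i = lam' j) {i : ℕ}
    (hi : 1 ≤ i) (hik : (i : ℕ∞) ≤ k)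
    (IH : ∀ j : ℕ, j < i → 1 ≤ j → (j : ℕ∞) ≤ k → lam j = lam' j) :
    (i : ℕ∞) ≤ k' ∧ lam i ≤ lam' i := by
  obtain ⟨j, hj, hjk, hij⟩ := hsub i hi hik
  rcases lt_trichotomy j i with hlt | rfl | hgt
  · have := h j i hj hlt hik
    have := IH j hlt hj (le_trans (by exact_mod_cast hlt.le) hik)
    linarith
  · exact ⟨hjk, hij.le⟩
  · exact ⟨le_trans (by exact_mod_cast hgt.le) hjk, hij.le.trans (h' i j hi hgt hjk).le⟩

/-- Two strictly decreasing sequences, finite or infinite, with the same set of values coincide. -/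
lemma eq_of_values_eq {k k' : ℕ∞} {lam lam' : ℕ → ℝ}
    (h : ∀ i j : ℕ, 1 ≤ i → i < j → (j : ℕ∞) ≤ k → lam j < lam i)
    (h' : ∀ i j : ℕ, 1 ≤ i → i < j → (j : ℕ∞) ≤ k' → lam' j < lam' i)
    (hsub : ∀ i : ℕ, 1 ≤ i → (i : ℕ∞) ≤ k → ∃ j : ℕ, 1 ≤ j ∧ (j : ℕ∞) ≤ k' ∧ lam i = lam' j)
    (hsub' : ∀ i : ℕ, 1 ≤ i → (i : ℕ∞) ≤ k' → ∃ j : ℕ, 1 ≤ j ∧ (j : ℕ∞) ≤ k ∧ lam' i = lam j) :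
    k = k' ∧ ∀ i : ℕ, 1 ≤ i → (i : ℕ∞) ≤ k → lam i = lam' i := by
  have key : ∀ i : ℕ, 1 ≤ i →
      ((i : ℕ∞) ≤ k ↔ (i : ℕ∞) ≤ k') ∧ ((i : ℕ∞) ≤ k → lam i = lam' i) := by
    intro i
    induction i using Nat.strong_induction_on with
    | _ i IH =>
      intro hi
      have h1 := fun hik => le_of_values_subset h h' hsub hi hik
        fun j hj hj1 hjk => (IH j hj hj1).2 hjk
      have h2 := fun hik => le_of_values_subset h' h hsub' hi hik
        fun j hj hj1 hjk => ((IH j hj hj1).2 ((IH j hj hj1).1.2 hjk)).symm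
      exact ⟨⟨fun hk => (h1 hk).1, fun hk => (h2 hk).1⟩,
        fun hk => le_antisymm (h1 hk).2 (h2 (h1 hk).1).2⟩
  refine ⟨ENat.eq_of_forall_natCast_le_iff fun i => ?_, fun i hi => (key i hi).2⟩
  rcases Nat.eq_zero_or_pos i with rfl | hi
  · simp
  · exact (key i hi).1

/-! ### The filtration in terms of rates -/

section Decomposition

variable {Ω X : Type*} [NormedAddCommGroup X] [NormedSpace ℝ X] {U : ℝ → Ω → X →L[ℝ] X}

/-- `u` has exponential growth rate `r` under `U_ω`. -/
def HasRate (U : ℝ → Ω → X →L[ℝ] X) (ω : Ω) (u : X) (r : EReal) : Prop :=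
  Tendsto (fun t : ℝ => logRate ‖U t ω u‖ t) atTop (𝓝 r)

/-- In a decreasing filtration whose steps carry the rates `lam i`, every vector has a rate, and the
rate decides to which members of the filtration it belongs. -/
lemma exists_hasRate_of_filtration {k : ℕ∞} {lam : ℕ → ℝ} {F : ℕ → Submodule ℝ X}
    {Finf : Submodule ℝ X} {ω : Ω}
    (hlam : ∀ i j : ℕ, 1 ≤ i → i < j → (j : ℕ∞) ≤ k → lam j < lam i)
    (hF0 : F 0 = ⊤) (hF : ∀ i j : ℕ, i ≤ j → (j : ℕ∞) ≤ k → F j ≤ F i)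
    (hFinf : ∀ u, u ∈ Finf ↔ ∀ i : ℕ, (i : ℕ∞) ≤ k → u ∈ F i)
    (hrate : ∀ i : ℕ, 1 ≤ i → (i : ℕ∞) ≤ k → ∀ u ∈ F (i - 1), u ∉ F i → HasRate U ω u (lam i))
    (hrate_inf : ∀ u ∈ Finf, HasRate U ω u ⊥) (u : X) :
    ∃ r : EReal, HasRate U ω u r ∧ (r = ⊥ ∨ ∃ i : ℕ, 1 ≤ i ∧ (i : ℕ∞) ≤ k ∧ r = lam i) ∧
      (∀ i : ℕ, 1 ≤ i → (i : ℕ∞) ≤ k → (u ∈ F i ↔ r < lam i)) ∧ (u ∈ Finf ↔ r = ⊥) := by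
  classical
  by_cases hu : u ∈ Finf
  · exact ⟨⊥, hrate_inf u hu, Or.inl rfl,
      fun i _ hik => iff_of_true ((hFinf u).1 hu i hik) (EReal.bot_lt_coe _), iff_of_true hu rfl⟩
  · have hex : ∃ i : ℕ, (i : ℕ∞) ≤ k ∧ u ∉ F i := by
      by_contra! h
      exact hu ((hFinf u).2 h)
    obtain ⟨hik, hui⟩ := Nat.find_spec hex
    have hmin := fun j => Nat.find_min (H := hex) (m := j)
    generalize Nat.find hex = i at hik hui hmin
    have hi : 1 ≤ i := by
      rcases Nat.eq_zero_or_pos i with rfl | h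
      · simp [hF0] at hui
      · exact h
    have hpred : u ∈ F (i - 1) := by
      by_contra h
      exact hmin (i - 1) (by omega) ⟨le_trans (by exact_mod_cast Nat.sub_le i 1) hik, h⟩
    refine ⟨lam i, hrate i hi hik u hpred hui, Or.inr ⟨i, hi, hik, rfl⟩, fun j hj hjk => ?_,
      iff_of_false hu (EReal.coe_ne_bot _)⟩
    rw [EReal.coe_lt_coe_iff]
    rcases lt_or_ge j i with hji | hij
    · refine iff_of_true ?_ (hlam j i hj hji hik)
      by_contra h
      exact hmin j hji ⟨hjk, h⟩
    · refine iff_of_false (fun h => hui (hF i j hij hjk h)) (not_lt.2 ?_)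
      rcases hij.eq_or_lt with rfl | hlt
      · exact le_rfl
      · exact (hlam i j hi hlt hjk).le

lemma hasRate_zero (ω : Ω) : HasRate U ω 0 ⊥ := by
  simp only [HasRate, map_zero, norm_zero]
  exact (tendsto_logRate_bot_iff (x := fun _ => 0)).2
    fun c => Eventually.of_forall fun t => Real.exp_pos _

variable [MeasurableSpace Ω] {P : Measure Ω} {θ : ℝ → Ω → Ω}

lemma OseledetsDecomposition.lam_strictAnti (D : OseledetsDecomposition P θ U) :
    ∀ i j : ℕ, 1 ≤ i → i < j → (j : ℕ∞) ≤ D.k → D.lam j < D.lam i := by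
  intro i j hi hij hj
  rcases D.cases with ⟨n, hk, h⟩ | ⟨-, h⟩
  · exact h.lam_lt i j hi hij (by rw [hk] at hj; exact_mod_cast hj)
  · exact h.lam_lt i j hi hij

/-- A trivial `E_i(ω)` would give the restriction of `U_ω(t)` the rate `-∞` instead of `λ_i`. -/
lemma OseledetsDecomposition.E_ne_bot (D : OseledetsDecomposition P θ U) {i : ℕ} (hi : 1 ≤ i)
    (hik : (i : ℕ∞) ≤ D.k) {ω : Ω} (hω : ω ∈ D.Ω₀) : D.E i ω ≠ ⊥ := by
  intro hbot
  have hrate : Tendsto (fun t : ℝ => logRate ‖(U t ω).comp (D.E i ω).subtypeL‖ t) atTop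
      (𝓝 (D.lam i : EReal)) := by
    rcases D.cases with ⟨n, hk, h⟩ | ⟨-, h⟩
    · exact h.rate_E_norm i hi (by rw [hk] at hik; exact_mod_cast hik) ω hω
    · exact h.rate_E_norm i hi ω hω
  have hz : ∀ t : ℝ, ‖(U t ω).comp (D.E i ω).subtypeL‖ = 0 := by
    intro t
    refine le_antisymm (ContinuousLinearMap.opNorm_le_bound _ le_rfl ?_)
      (ContinuousLinearMap.opNorm_nonneg _)
    rintro ⟨u, hu⟩
    rw [hbot, Submodule.mem_bot] at hu
    subst hu
    simp
  have hrate' : Tendsto (fun t : ℝ => logRate ‖(U t ω).comp (D.E i ω).subtypeL‖ t) atTop (𝓝 ⊥) := by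
    simp only [hz]
    exact (tendsto_logRate_bot_iff (x := fun _ => 0)).2
      fun c => Eventually.of_forall fun t => Real.exp_pos _
  exact EReal.coe_ne_bot _ (tendsto_nhds_unique hrate hrate')

lemma OseledetsDecomposition.one_le_k (D : OseledetsDecomposition P θ U) :
    ((1 : ℕ) : ℕ∞) ≤ D.k := by
  rcases D.cases with ⟨n, hk, h⟩ | ⟨hk, -⟩
  · rw [hk]; exact_mod_cast h.one_le
  · rw [hk]; exact le_top

/-- Since `U_ω(t)` maps `E_1(ω)` onto `E_1(θ_t ω) ≠ 0`, it does not vanish. -/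
lemma OseledetsDecomposition.semiflow_ne_zero (D : OseledetsDecomposition P θ U) {ω : Ω}
    (hω : ω ∈ D.Ω₀) {t : ℝ} (ht : 0 ≤ t) : U t ω ≠ 0 := by
  intro h0
  have hmap : (D.E 1 ω).map (U t ω).toLinearMap = D.E 1 (θ t ω) := by
    rcases D.cases with ⟨n, -, h⟩ | ⟨-, h⟩
    · exact h.map_E 1 le_rfl h.one_le ω hω t ht
    · exact h.map_E 1 le_rfl ω hω t ht
  have hθ : θ t ω ∈ D.Ω₀ := by rw [← D.invariant t] at hω; exact hω
  refine D.E_ne_bot le_rfl D.one_le_k hθ ?_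
  rw [← hmap, h0]
  simp [Submodule.map_zero]

lemma OseledetsDecomposition.exists_hasRate_lam (D : OseledetsDecomposition P θ U) {i : ℕ}
    (hi : 1 ≤ i) (hik : (i : ℕ∞) ≤ D.k) {ω : Ω} (hω : ω ∈ D.Ω₀) :
    ∃ u, HasRate U ω u (D.lam i) := by
  obtain ⟨u, hu, hu0⟩ := Submodule.exists_mem_ne_zero_of_ne_bot (D.E_ne_bot hi hik hω)
  refine ⟨u, ?_⟩
  rcases D.cases with ⟨n, hk, h⟩ | ⟨-, h⟩
  · exact h.rate_E i hi (by rw [hk] at hik; exact_mod_cast hik) ω hω u hu hu0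
  · exact h.rate_E i hi ω hω u hu hu0

lemma OseledetsDecomposition.exists_hasRate (D : OseledetsDecomposition P θ U) {ω : Ω}
    (hω : ω ∈ D.Ω₀) (u : X) :
    ∃ r : EReal, HasRate U ω u r ∧ (r = ⊥ ∨ ∃ i : ℕ, 1 ≤ i ∧ (i : ℕ∞) ≤ D.k ∧ r = D.lam i) ∧
      (∀ i : ℕ, 1 ≤ i → (i : ℕ∞) ≤ D.k → (u ∈ D.F i ω ↔ r < D.lam i)) ∧
      (u ∈ D.Finf ω ↔ r = ⊥) := by
  rcases D.cases with ⟨n, hk, h⟩ | ⟨hk, h⟩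
  · have hkn : ∀ i : ℕ, (i : ℕ∞) ≤ D.k ↔ i ≤ n := fun i => by rw [hk, Nat.cast_le]
    have hF0 : D.F 0 ω = ⊤ := by
      refine eq_top_iff.2 ((h.directSum ω hω).submodule_iSup_eq_top.symm.le.trans ?_)
      rw [h.F_eq 0 n.zero_le ω hω]
      refine iSup_le ?_
      rintro (_ | j)
      · exact le_sup_right
      · refine le_sup_of_le_left (le_iSup₂_of_le (j.val + 1) ?_ le_rfl)
        rw [Finset.mem_Icc]; omega
    have hF : ∀ i j : ℕ, i ≤ j → (j : ℕ∞) ≤ D.k → D.F j ω ≤ D.F i ω := by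
      intro i j hij hj
      have hjn := (hkn j).1 hj
      rw [h.F_eq j hjn ω hω, h.F_eq i (hij.trans hjn) ω hω]
      exact sup_le_sup_right
        (biSup_mono fun m hm => Finset.Icc_subset_Icc_left (Nat.succ_le_succ hij) hm) _
    have hFn : D.F n ω = D.Finf ω := by
      rw [h.F_eq n le_rfl ω hω]
      simp
    refine exists_hasRate_of_filtration (F := fun i => D.F i ω) D.lam_strictAnti hF0 hF
      (fun v => ⟨fun hv i hi => ?_, fun hv => hFn.le (hv n hk.ge)⟩)
      (fun i hi hik => h.rate_F i hi ((hkn i).1 hik) ω hω) (fun v hv => ?_) u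
    · exact hF i n ((hkn i).1 hi) hk.ge (hFn.ge hv)
    · exact tendsto_logRate_bot_of_le (norm_nonneg v) (h.rate_Finf ω hω) fun t =>
        ((U t ω).comp (D.Finf ω).subtypeL).le_opNorm ⟨v, hv⟩
  · have hik : ∀ i : ℕ, (i : ℕ∞) ≤ D.k := fun i => by rw [hk]; exact le_top
    have hF : ∀ i j : ℕ, i ≤ j → (j : ℕ∞) ≤ D.k → D.F j ω ≤ D.F i ω := by
      intro i j hij _
      refine antitone_nat_of_succ_le (f := fun i => D.F i ω) (fun j => ?_) hij
      rcases Nat.eq_zero_or_pos j with rfl | hj0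
      · exact le_top.trans (h.F_zero ω hω).ge
      · exact le_sup_right.trans (h.F_eq j hj0 ω hω).2.ge
    refine exists_hasRate_of_filtration (F := fun i => D.F i ω) D.lam_strictAnti (h.F_zero ω hω) hF
      (fun v => ?_) (fun i hi _ => h.rate_F i hi ω hω) (fun v hv => ?_) u
    · rw [h.Finf_eq ω hω, Submodule.mem_iInf]
      refine ⟨fun hv i _ => ?_, fun hv i => hv (i + 1) (hik _)⟩
      exact hF i (i + 1) i.le_succ (hik _) (hv i)
    · rcases eq_or_ne v 0 with rfl | hv0
      · exact hasRate_zero ω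
      · exact h.rate_Finf ω hω v hv hv0

lemma OseledetsDecomposition.mem_F_iff (D : OseledetsDecomposition P θ U) {ω : Ω}
    (hω : ω ∈ D.Ω₀) {u : X} {r : EReal} (hr : HasRate U ω u r) {i : ℕ} (hi : 1 ≤ i)
    (hik : (i : ℕ∞) ≤ D.k) : u ∈ D.F i ω ↔ r < D.lam i := by
  obtain ⟨r', hr', -, h, -⟩ := D.exists_hasRate hω u
  rw [h i hi hik, tendsto_nhds_unique hr hr']

lemma OseledetsDecomposition.mem_Finf_iff (D : OseledetsDecomposition P θ U) {ω : Ω}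
    (hω : ω ∈ D.Ω₀) {u : X} {r : EReal} (hr : HasRate U ω u r) : u ∈ D.Finf ω ↔ r = ⊥ := by
  obtain ⟨r', hr', -, -, h⟩ := D.exists_hasRate hω u
  rw [h, tendsto_nhds_unique hr hr']

/-- The only finite rates are the Lyapunov exponents. -/
lemma OseledetsDecomposition.eq_lam_of_hasRate (D : OseledetsDecomposition P θ U) {ω : Ω}
    (hω : ω ∈ D.Ω₀) {u : X} {c : ℝ} (hr : HasRate U ω u c) :
    ∃ i : ℕ, 1 ≤ i ∧ (i : ℕ∞) ≤ D.k ∧ c = D.lam i := by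
  obtain ⟨r', hr', h, -⟩ := D.exists_hasRate hω u
  rw [← tendsto_nhds_unique hr hr'] at h
  rcases h with h | ⟨i, hi, hik, h⟩
  · exact absurd h (EReal.coe_ne_bot c)
  · exact ⟨i, hi, hik, by exact_mod_cast h⟩

end Decomposition

/-! ### A Gronwall inequality with an integrable kernel -/

/-- Over a stretch on which the kernel has integral at most `1/2`, the right-hand side
`c + ∫ a φ` of the integral inequality at most doubles; hence the bound `2 ^ (n + 1) * c`. -/
lemma gronwall_of_integral_le {a φ : ℝ → ℝ} {c : ℝ} (ha : ∀ t, 0 ≤ a t)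
    (hφ : ∀ t ∈ Set.Icc (0 : ℝ) 1, 0 ≤ φ t) (hai : IntervalIntegrable a volume 0 1)
    (haφ : IntervalIntegrable (fun s => a s * φ s) volume 0 1)
    (h : ∀ t ∈ Set.Icc (0 : ℝ) 1, φ t ≤ c + ∫ s in (0 : ℝ)..t, a s * φ s) (n : ℕ) :
    ∀ T ∈ Set.Icc (0 : ℝ) 1, ∫ s in (0 : ℝ)..T, a s ≤ (n + 1) / 2 →
      c + ∫ s in (0 : ℝ)..T, a s * φ s ≤ 2 ^ (n + 1) * c := by
  have h01 : (0 : ℝ) ∈ Set.Icc (0 : ℝ) 1 := by simp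
  have hc : 0 ≤ c := by simpa using (hφ 0 h01).trans (h 0 h01)
  have hsub : ∀ {f : ℝ → ℝ} {s t : ℝ}, IntervalIntegrable f volume 0 1 → s ∈ Set.Icc (0 : ℝ) 1 →
      t ∈ Set.Icc (0 : ℝ) 1 → IntervalIntegrable f volume s t := by
    intro f s t hf hs ht
    refine hf.mono_set ?_
    rw [Set.uIcc_of_le zero_le_one]
    exact Set.ordConnected_Icc.uIcc_subset hs ht
  have step : ∀ T₁ ∈ Set.Icc (0 : ℝ) 1, ∀ T ∈ Set.Icc (0 : ℝ) 1, T₁ ≤ T →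
      ∫ s in T₁..T, a s ≤ 1 / 2 →
      c + ∫ s in (0 : ℝ)..T, a s * φ s ≤ 2 * (c + ∫ s in (0 : ℝ)..T₁, a s * φ s) := by
    intro T₁ h₁ T hT hle hA
    set G := c + ∫ s in (0 : ℝ)..T, a s * φ s with hG
    have hG0 : 0 ≤ G := (hφ T hT).trans (h T hT)
    have hφG : ∀ s ∈ Set.Icc T₁ T, φ s ≤ G := by
      intro s hs
      have hs' : s ∈ Set.Icc (0 : ℝ) 1 := ⟨h₁.1.trans hs.1, hs.2.trans hT.2⟩
      refine (h s hs').trans ?_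
      rw [hG, ← intervalIntegral.integral_add_adjacent_intervals (hsub haφ h01 hs')
        (hsub haφ hs' hT)]
      have : 0 ≤ ∫ r in s..T, a r * φ r := intervalIntegral.integral_nonneg hs.2 fun r hr =>
        mul_nonneg (ha r) (hφ r ⟨hs'.1.trans hr.1, hr.2.trans hT.2⟩)
      linarith
    have hint : ∫ s in T₁..T, a s * φ s ≤ (∫ s in T₁..T, a s) * G := by
      rw [← intervalIntegral.integral_mul_const]
      exact intervalIntegral.integral_mono_on hle (hsub haφ h₁ hT) ((hsub hai h₁ hT).mul_const G)
        fun s hs => mul_le_mul_of_nonneg_left (hφG s hs) (ha s)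
    have hadd := intervalIntegral.integral_add_adjacent_intervals (hsub haφ h01 h₁)
      (hsub haφ h₁ hT)
    nlinarith [mul_le_mul_of_nonneg_right hA hG0]
  induction n with
  | zero =>
    intro T hT hA
    simpa using step 0 h01 T hT hT.1 (by simpa using hA)
  | succ n IH =>
    intro T hT hA
    have hpow : (2 : ℝ) ^ (n + 1 + 1) * c = 2 * (2 ^ (n + 1) * c) := by ring
    rcases le_or_gt (∫ s in (0 : ℝ)..T, a s) ((n + 1) / 2) with hle | hgt
    · have : 0 ≤ (2 : ℝ) ^ (n + 1) * c := by positivity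
      linarith [IH T hT hle]
    · have hcont : ContinuousOn (fun t => ∫ s in (0 : ℝ)..t, a s) (Set.Icc 0 T) := by
        have := intervalIntegral.continuousOn_primitive_interval (μ := volume) (f := a)
          (a := 0) (b := T) ((intervalIntegrable_iff' (by simp)).1 (hsub hai h01 hT))
        rwa [Set.uIcc_of_le hT.1] at this
      obtain ⟨T₁, h₁, hT₁⟩ := intermediate_value_Icc hT.1 hcont
        ⟨by simp only [intervalIntegral.integral_same]; positivity, hgt.le⟩
      have h₁' : T₁ ∈ Set.Icc (0 : ℝ) 1 := ⟨h₁.1, h₁.2.trans hT.2⟩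
      have hadd := intervalIntegral.integral_add_adjacent_intervals (hsub hai h01 h₁')
        (hsub hai h₁' hT)
      simp only at hT₁
      push_cast at hA
      have := step T₁ h₁' T hT h₁.2 (by linarith)
      linarith [IH T₁ h₁' hT₁.le]

/-! ### The delay interval -/

lemma measurePreserving_delayIcc_coe :
    MeasurePreserving (Subtype.val : DelayIcc → ℝ) delayVol
      (volume.restrict (Set.Icc (-1 : ℝ) 0)) :=
  measurePreserving_subtype_coe measurableSet_Icc

lemma measurableEmbedding_delayIcc_coe : MeasurableEmbedding (Subtype.val : DelayIcc → ℝ) :=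
  MeasurableEmbedding.subtype_coe measurableSet_Icc

lemma ae_delayVol_iff {p : ℝ → Prop} :
    (∀ᵐ s : DelayIcc ∂delayVol, p s) ↔ ∀ᵐ r : ℝ, r ∈ Set.Icc (-1 : ℝ) 0 → p r := by
  rw [← ae_restrict_iff' measurableSet_Icc, ← measurePreserving_delayIcc_coe.map_eq,
    measurableEmbedding_delayIcc_coe.ae_map_iff]

lemma ae_delayVol_lt_zero : ∀ᵐ s : DelayIcc ∂delayVol, (s : ℝ) < 0 := by
  rw [ae_delayVol_iff (p := fun r => r < 0)]
  filter_upwards [compl_mem_ae_iff.2 (measure_singleton (0 : ℝ))] with r hr h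
  exact lt_of_le_of_ne h.2 hr

lemma measurePreserving_delayIcc_add_one :
    MeasurePreserving (fun s : DelayIcc => (s : ℝ) + 1) delayVol
      (volume.restrict (Set.Ioc (0 : ℝ) 1)) := by
  have h := (measurePreserving_add_right volume (1 : ℝ)).restrict_preimage_emb
    (measurableEmbedding_addRight 1) (Set.Icc 0 1)
  have hpre : (fun x : ℝ => x + 1) ⁻¹' Set.Icc 0 1 = Set.Icc (-1) 0 := by
    ext x; simp only [Set.mem_preimage, Set.mem_Icc]; constructor <;> rintro ⟨h1, h2⟩ <;>
      constructor <;> linarith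
  rw [hpre] at h
  rw [Measure.restrict_congr_set Ioc_ae_eq_Icc]
  exact h.comp measurePreserving_delayIcc_coe

/-- Every nonempty relatively open subset of `[-1, 0]` meets `(-1, 0)`. This makes the embedding of
`C` into `L_p` injective. -/
instance : delayVol.IsOpenPosMeasure := by
  constructor
  rintro U hU ⟨x, hx⟩ h0
  obtain ⟨V, hV, rfl⟩ := isOpen_induced_iff.1 hU
  have hcl : (x : ℝ) ∈ closure (Set.Ioo (-1 : ℝ) 0) := by
    rw [closure_Ioo (by norm_num)]; exact x.2
  have hne : (V ∩ Set.Ioo (-1 : ℝ) 0).Nonempty := mem_closure_iff.1 hcl V hV hx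
  refine (hV.inter isOpen_Ioo).measure_ne_zero volume hne (measure_mono_null ?_
    ((comap_subtype_coe_apply measurableSet_Icc volume _).symm.trans h0))
  rintro r ⟨hrV, hr⟩
  exact ⟨⟨r, hr.1.le, hr.2.le⟩, hrV, rfl⟩

/-! ### Solutions of the delay equation -/

section Delay

variable {Ω : Type*} {N : ℕ} {θ : ℝ → Ω → Ω} {A B : Ω → Matrix (Fin N) (Fin N) ℝ} {ω : Ω}

lemma mem_regularSet_shift (hadd : ∀ s t ω, θ (s + t) ω = θ t (θ s ω)) {q : ℝ}
    (h : ω ∈ regularSet θ A B q) (s : ℝ) : θ s ω ∈ regularSet θ A B q := by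
  have key : ∀ f : ℝ → ℝ, LocallyIntegrable f → LocallyIntegrable fun t => f (s + t) := by
    intro f hf
    have := (locallyIntegrable_map_homeomorph (Homeomorph.addLeft s) (f := f) (μ := volume)).1
      (by simpa [Homeomorph.coe_addLeft, map_add_left_eq_self] using hf)
    exact this
  refine ⟨?_, ?_⟩
  · simpa only [hadd] using key _ h.1
  · simpa only [hadd] using key _ h.2

namespace IsDelaySolution

variable {x x' : EucN N} {φ φ' : DelayIcc → EucN N} {z z' : ℝ → EucN N}

/-- A solution restarted at time `s` solves the equation over `θ_s ω`. -/
lemma shift (hadd : ∀ s t ω, θ (s + t) ω = θ t (θ s ω)) (hz : IsDelaySolution θ A B ω x φ z)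
    {s : ℝ} (hs : 0 ≤ s) :
    IsDelaySolution θ A B (θ s ω) (z s) (fun r => z (s + r)) (fun r => z (s + r)) := by
  set g : ℝ → EucN N := fun r => matOp (A (θ r ω)) (z r) + matOp (B (θ r ω)) (z (r - 1)) with hg
  have hgs : ∀ r, matOp (A (θ r (θ s ω))) (z (s + r)) + matOp (B (θ r (θ s ω))) (z (s + (r - 1)))
      = g (s + r) := by
    intro r
    simp only [hg, hadd, add_sub_assoc]
  have hint : ∀ t, 0 ≤ t → IntervalIntegrable g volume s (s + t) := fun t ht =>
    (hz.integrable (s + t) (by positivity)).mono_set (by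
      rw [Set.uIcc_of_le (by linarith), Set.uIcc_of_le (by linarith)]
      exact Set.Icc_subset_Icc_left hs)
  refine ⟨by simp, fun _ _ => rfl, ?_, fun t ht => ?_, fun t ht => ?_⟩
  · exact hz.continuousOn.comp (by fun_prop) fun r hr => add_nonneg hs hr
  · simp only [hgs]
    have := (hint t ht).comp_add_left (c := s)
    simpa using this
  · simp only [hgs]
    rw [intervalIntegral.integral_comp_add_left (fun r => g r) s, add_zero,
      hz.eq (s + t) (by positivity), hz.eq s hs, add_assoc,
      intervalIntegral.integral_add_adjacent_intervals (hz.integrable s hs) (hint t ht)]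

lemma sub (hz : IsDelaySolution θ A B ω x φ z) (hz' : IsDelaySolution θ A B ω x' φ' z') :
    IsDelaySolution θ A B ω (x - x') (φ - φ') (z - z') := by
  have hg : ∀ r, matOp (A (θ r ω)) ((z - z') r) + matOp (B (θ r ω)) ((z - z') (r - 1)) =
      (matOp (A (θ r ω)) (z r) + matOp (B (θ r ω)) (z (r - 1))) -
      (matOp (A (θ r ω)) (z' r) + matOp (B (θ r ω)) (z' (r - 1))) := by
    intro r
    simp only [Pi.sub_apply, map_sub]
    abel
  refine ⟨by simp [hz.init, hz'.init], fun s hs => by simp [hz.history s hs, hz'.history s hs],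
    hz.continuousOn.sub hz'.continuousOn, fun t ht => ?_, fun t ht => ?_⟩
  · simp only [hg]
    exact (hz.integrable t ht).sub (hz'.integrable t ht)
  · simp only [hg]
    rw [intervalIntegral.integral_sub (hz.integrable t ht) (hz'.integrable t ht), Pi.sub_apply,
      hz.eq t ht, hz'.eq t ht]
    abel

/-- A bound over one delay interval by the norm of the initial data in `ℝ^N × L_p`, in which the
coefficients enter only through the integrals of `‖A‖` and `‖B‖ ^ q`. -/
lemma norm_le {p : ENNReal} {q : ℝ} (hp : p ≠ ⊤)
    (hpq : p.toReal.HolderConjugate q) (hreg : ω ∈ regularSet θ A B q)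
    (hz : IsDelaySolution θ A B ω x φ z) (u : Lp (EucN N) p delayVol) (hu : φ =ᵐ[delayVol] u)
    (n : ℕ) (hn : ∫ s in (0 : ℝ)..1, ‖matOp (A (θ s ω))‖ ≤ (n + 1) / 2) {t : ℝ}
    (ht : t ∈ Set.Icc (0 : ℝ) 1) :
    ‖z t‖ ≤ 2 ^ (n + 1) *
      (‖x‖ + (∫ s in (0 : ℝ)..1, ‖matOp (B (θ s ω))‖ ^ q) ^ (1 / q) * ‖u‖) := by
  set a : ℝ → ℝ := fun s => ‖matOp (A (θ s ω))‖ with ha_def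
  set b : ℝ → ℝ := fun s => ‖matOp (B (θ s ω))‖ with hb_def
  have hp0 : p ≠ 0 := fun h => by simpa [h] using hpq.pos
  have hai : IntervalIntegrable a volume 0 1 :=
    (hreg.1.integrableOn_isCompact isCompact_uIcc).intervalIntegrable
  have hbi : IntegrableOn (fun s => b s ^ q) (Set.Ioc 0 1) :=
    (hreg.2.integrableOn_isCompact isCompact_Icc).mono_set Set.Ioc_subset_Icc_self
  have hb_mem : MemLp b (ENNReal.ofReal q) (volume.restrict (Set.Ioc (0 : ℝ) 1)) := by
    have hm : AEStronglyMeasurable b (volume.restrict (Set.Ioc (0 : ℝ) 1)) := by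
      have : b = fun s => (b s ^ q) ^ (1 / q) := by
        ext s
        rw [← Real.rpow_mul (norm_nonneg _), mul_one_div_cancel hpq.symm.ne_zero, Real.rpow_one]
      rw [this]
      exact (hbi.aestronglyMeasurable.aemeasurable.pow_const _).aestronglyMeasurable
    rw [← integrable_norm_rpow_iff hm (by simpa using hpq.symm.pos) ENNReal.ofReal_ne_top,
      ENNReal.toReal_ofReal hpq.symm.nonneg]
    refine Integrable.congr hbi (Eventually.of_forall fun s => ?_)
    simp only [hb_def, norm_norm]
  -- the delayed argument `z (s - 1)`, `s ∈ (0, 1]`, carries the history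
  have hhist : (fun s : ℝ => z (s - 1)) ∘ (fun s : DelayIcc => (s : ℝ) + 1) =ᵐ[delayVol] u := by
    filter_upwards [ae_delayVol_lt_zero, hu] with s hs hus
    simp [hz.history s hs, hus]
  have hemb : MeasurableEmbedding fun s : DelayIcc => (s : ℝ) + 1 :=
    (measurableEmbedding_addRight 1).comp measurableEmbedding_delayIcc_coe
  have hf_mem : MemLp (fun s => ‖z (s - 1)‖) (ENNReal.ofReal p.toReal)
      (volume.restrict (Set.Ioc (0 : ℝ) 1)) := by
    rw [ENNReal.ofReal_toReal hp, ← measurePreserving_delayIcc_add_one.map_eq]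
    refine MemLp.norm (f := fun s => z (s - 1)) ?_
    rw [hemb.memLp_map_measure_iff]
    exact (memLp_congr_ae hhist).2 (Lp.memLp u)
  have hf_norm : (∫ s in Set.Ioc (0 : ℝ) 1, ‖z (s - 1)‖ ^ p.toReal) ^ (1 / p.toReal) = ‖u‖ := by
    rw [← measurePreserving_delayIcc_add_one.map_eq, hemb.integral_map,
      Lp.norm_def, (Lp.memLp u).eLpNorm_eq_integral_rpow_norm hp0 hp,
      ENNReal.toReal_ofReal (by positivity), one_div]
    congr 1
    refine integral_congr_ae ?_
    filter_upwards [hhist] with s hs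
    simp only [Function.comp_apply] at hs
    rw [hs]
  have hbf : Integrable (fun s => b s * ‖z (s - 1)‖) (volume.restrict (Set.Ioc (0 : ℝ) 1)) := by
    have : ENNReal.HolderConjugate (ENNReal.ofReal q) (ENNReal.ofReal p.toReal) :=
      hpq.symm.ennrealOfReal
    exact hb_mem.integrable_mul hf_mem
  have hholder : ∫ s in Set.Ioc (0 : ℝ) 1, b s * ‖z (s - 1)‖ ≤
      (∫ s in (0 : ℝ)..1, b s ^ q) ^ (1 / q) * ‖u‖ := by
    rw [intervalIntegral.integral_of_le zero_le_one, ← hf_norm]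
    exact integral_mul_le_Lp_mul_Lq_of_nonneg hpq.symm
      (Eventually.of_forall fun s => norm_nonneg _) (Eventually.of_forall fun s => norm_nonneg _)
      hb_mem hf_mem
  have hzc : ContinuousOn (fun s => ‖z s‖) (Set.uIcc 0 1) := by
    rw [Set.uIcc_of_le zero_le_one]
    exact (hz.continuousOn.mono Set.Icc_subset_Ici_self).norm
  have haz : IntervalIntegrable (fun s => a s * ‖z s‖) volume 0 1 := hai.mul_continuousOn hzc
  have hbf' : IntervalIntegrable (fun s => b s * ‖z (s - 1)‖) volume 0 1 := by
    rwa [intervalIntegrable_iff_integrableOn_Ioc_of_le zero_le_one]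
  set c := ‖x‖ + ∫ s in Set.Ioc (0 : ℝ) 1, b s * ‖z (s - 1)‖ with hc
  have hineq : ∀ t ∈ Set.Icc (0 : ℝ) 1, ‖z t‖ ≤ c + ∫ s in (0 : ℝ)..t, a s * ‖z s‖ := by
    intro t ht
    have hsub : ∀ {f : ℝ → ℝ}, IntervalIntegrable f volume 0 1 → IntervalIntegrable f volume 0 t :=
      fun hf => hf.mono_set (by
        rw [Set.uIcc_of_le zero_le_one, Set.uIcc_of_le ht.1]
        exact Set.Icc_subset_Icc_right ht.2)
    have h1 : ‖∫ s in (0 : ℝ)..t, (matOp (A (θ s ω)) (z s) + matOp (B (θ s ω)) (z (s - 1)))‖ ≤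
        ∫ s in (0 : ℝ)..t, (a s * ‖z s‖ + b s * ‖z (s - 1)‖) :=
      intervalIntegral.norm_integral_le_of_norm_le ht.1
        (Eventually.of_forall fun s _ => (norm_add_le _ _).trans
          (add_le_add (ContinuousLinearMap.le_opNorm _ _) (ContinuousLinearMap.le_opNorm _ _)))
        ((hsub haz).add (hsub hbf'))
    rw [intervalIntegral.integral_add (hsub haz) (hsub hbf')] at h1
    have h2 : ∫ s in (0 : ℝ)..t, b s * ‖z (s - 1)‖ ≤
        ∫ s in Set.Ioc (0 : ℝ) 1, b s * ‖z (s - 1)‖ := by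
      rw [intervalIntegral.integral_of_le ht.1]
      exact setIntegral_mono_set hbf (Eventually.of_forall fun s => by positivity)
        (Set.Ioc_subset_Ioc_right ht.2).eventuallyLE
    rw [hz.eq t ht.1]
    linarith [norm_add_le x
      (∫ s in (0 : ℝ)..t, (matOp (A (θ s ω)) (z s) + matOp (B (θ s ω)) (z (s - 1))))]
  have hmono : ∫ s in (0 : ℝ)..t, a s ≤ ∫ s in (0 : ℝ)..1, a s :=
    intervalIntegral.integral_mono_interval le_rfl ht.1 ht.2
      (Eventually.of_forall fun s => norm_nonneg _) hai
  calc ‖z t‖ ≤ c + ∫ s in (0 : ℝ)..t, a s * ‖z s‖ := hineq t ht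
    _ ≤ 2 ^ (n + 1) * c := gronwall_of_integral_le (fun s => norm_nonneg _)
        (fun s _ => norm_nonneg _) hai haz hineq n t ht (hmono.trans hn)
    _ ≤ _ := mul_le_mul_of_nonneg_left (by linarith) (by positivity)

lemma eqOn_zero_of_history {q : ℝ} {p : ENNReal} [Fact (1 ≤ p)] (hp : p ≠ ⊤)
    (hpq : p.toReal.HolderConjugate q) (hadd : ∀ s t ω, θ (s + t) ω = θ t (θ s ω))
    (hreg : ω ∈ regularSet θ A B q) (hz : IsDelaySolution θ A B ω 0 φ z)
    (hφ : φ =ᵐ[delayVol] 0) {t : ℝ} (ht : 0 ≤ t) : z t = 0 := by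
  -- one delay interval, by the norm bound with zero data
  have step : ∀ {ω : Ω} {φ : DelayIcc → EucN N} {z : ℝ → EucN N}, ω ∈ regularSet θ A B q →
      IsDelaySolution θ A B ω 0 φ z → φ =ᵐ[delayVol] 0 → ∀ t ∈ Set.Icc (0 : ℝ) 1, z t = 0 := by
    intro ω φ z hreg hz hφ t ht
    obtain ⟨n, hn⟩ := exists_nat_ge (2 * ∫ s in (0 : ℝ)..1, ‖matOp (A (θ s ω))‖)
    have := hz.norm_le hp hpq hreg (0 : Lp (EucN N) p delayVol)
      (hφ.trans (Lp.coeFn_zero _ _ _).symm) n (by linarith) ht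
    simpa using this
  have key : ∀ n : ℕ, ∀ t ∈ Set.Icc (0 : ℝ) (n + 1), z t = 0 := by
    intro n
    induction n with
    | zero => simpa using step hreg hz hφ
    | succ n IH =>
      intro t ht
      push_cast at ht
      rcases le_or_gt t (n + 1) with hle | hgt
      · exact IH t ⟨ht.1, hle⟩
      · have hshift := hz.shift hadd (s := n + 1) (by positivity)
        rw [IH (n + 1) ⟨by positivity, le_rfl⟩] at hshift
        have := step (mem_regularSet_shift hadd hreg _) hshift
          (Eventually.of_forall fun s => IH _
            ⟨by have := s.2.1; have : (0 : ℝ) ≤ n := n.cast_nonneg; linarith,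
              by have := s.2.2; linarith⟩) (t - (n + 1)) ⟨by linarith, by linarith [ht.2]⟩
        simpa using this
  obtain ⟨n, hn⟩ := exists_nat_ge t
  exact key n t ⟨ht, hn.trans (by linarith)⟩

/-- Uniqueness: solutions with almost everywhere equal histories agree at nonnegative times. -/
lemma unique {q : ℝ} {p : ENNReal} [Fact (1 ≤ p)] (hp : p ≠ ⊤)
    (hpq : p.toReal.HolderConjugate q) (hadd : ∀ s t ω, θ (s + t) ω = θ t (θ s ω))
    (hreg : ω ∈ regularSet θ A B q) (hz : IsDelaySolution θ A B ω x φ z)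
    (hz' : IsDelaySolution θ A B ω x φ' z') (hφ : φ =ᵐ[delayVol] φ') {t : ℝ} (ht : 0 ≤ t) :
    z t = z' t := by
  have hsub := hz.sub hz'
  rw [sub_self] at hsub
  refine sub_eq_zero.1 (hsub.eqOn_zero_of_history hp hpq hadd hreg ?_ ht)
  filter_upwards [hφ] with s hs
  simp [hs]

lemma unique_segment {q : ℝ} {p : ENNReal} [Fact (1 ≤ p)] (hp : p ≠ ⊤)
    (hpq : p.toReal.HolderConjugate q) (hadd : ∀ s t ω, θ (s + t) ω = θ t (θ s ω))
    (hreg : ω ∈ regularSet θ A B q) (hz : IsDelaySolution θ A B ω x φ z)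
    (hz' : IsDelaySolution θ A B ω x φ' z') (hφ : φ =ᵐ[delayVol] φ') {t : ℝ} (ht : 0 ≤ t) :
    (fun s : DelayIcc => z (t + s)) =ᵐ[delayVol] fun s => z' (t + s) := by
  have hneg : ∀ᵐ s : DelayIcc ∂delayVol, z s = z' s := by
    filter_upwards [hφ, ae_delayVol_lt_zero] with s hs hs0
    rw [hz.history s hs0, hz'.history s hs0, hs]
  rw [ae_delayVol_iff (p := fun r => z r = z' r)] at hneg
  refine (ae_delayVol_iff (p := fun r => z (t + r) = z' (t + r))).2 ?_
  filter_upwards [(quasiMeasurePreserving_add_left volume t).ae hneg] with r hr hrI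
  rcases le_or_gt 0 (t + r) with h | h
  · exact hz.unique hp hpq hadd hreg hz' hφ h
  · exact hr ⟨by linarith [hrI.1], h.le⟩

end IsDelaySolution

end Delay

/-! ### Solution operators -/

lemma spaceL_ext {N : ℕ} {p : ENNReal} {u v : SpaceL N p} (h1 : u.fst = v.fst)
    (h2 : u.snd =ᵐ[delayVol] v.snd) : u = v :=
  WithLp.ofLp_injective _ (Prod.ext h1 (Lp.ext h2))

section SolutionOperators

variable {Ω : Type*} {N : ℕ} {θ : ℝ → Ω → Ω} {A B : Ω → Matrix (Fin N) (Fin N) ℝ} {ω : Ω}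
  {p : ENNReal} [Fact (1 ≤ p)] {q : ℝ}

lemma isSolOpC_semiflowC {t : ℝ} (h : semiflowC θ A B t ω ≠ 0) :
    IsSolOpC θ A B t ω (semiflowC θ A B t ω) := by
  unfold semiflowC at h ⊢
  split_ifs at h ⊢ with hex
  · exact hex.choose_spec
  · exact absurd rfl h

lemma isSolOpL_semiflowL {t : ℝ} (h : semiflowL p θ A B t ω ≠ 0) :
    IsSolOpL p θ A B t ω (semiflowL p θ A B t ω) := by
  unfold semiflowL at h ⊢
  split_ifs at h ⊢ with hex
  · exact hex.choose_spec
  · exact absurd rfl h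

lemma isSolOpLC_semiflowLC {t : ℝ} (h : ∃ T, IsSolOpLC p θ A B t ω T) :
    IsSolOpLC p θ A B t ω (semiflowLC p θ A B t ω) := by
  unfold semiflowLC
  rw [dif_pos h]
  exact h.choose_spec

lemma embJ_fst (u : SpaceC N) : (embJ N p u).fst = u DelayIcc.zero := rfl

lemma embJ_snd (u : SpaceC N) : (embJ N p u).snd =ᵐ[delayVol] u :=
  ContinuousMap.coeFn_toLp (p := p) (𝕜 := ℝ) delayVol u

lemma embJ_injective : Function.Injective (embJ N p) := by
  intro u v h
  have h2 : ContinuousMap.toLp p delayVol ℝ u = ContinuousMap.toLp p delayVol ℝ v :=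
    congrArg (fun w : SpaceL N p => w.snd) h
  exact ContinuousMap.toLp_injective delayVol h2

/-- `J` intertwines the solution operators on `C` and `L`. -/
lemma IsSolOpL.apply_embJ (hp : p ≠ ⊤) (hpq : p.toReal.HolderConjugate q)
    (hadd : ∀ s t ω, θ (s + t) ω = θ t (θ s ω)) (hreg : ω ∈ regularSet θ A B q) {t : ℝ}
    (ht : 0 ≤ t) {S : SpaceL N p →L[ℝ] SpaceL N p} {T : SpaceC N →L[ℝ] SpaceC N}
    (hS : IsSolOpL p θ A B t ω S) (hT : IsSolOpC θ A B t ω T) (u : SpaceC N) :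
    S (embJ N p u) = embJ N p (T u) := by
  obtain ⟨z, hz, hTz⟩ := hT u
  obtain ⟨z', hz', hS1, hS2⟩ := hS (embJ N p u)
  rw [embJ_fst] at hz'
  have hhist := embJ_snd (p := p) u
  refine spaceL_ext ?_ ?_
  · rw [hS1, embJ_fst, hTz, hz'.unique hp hpq hadd hreg hz hhist ht]
    simp [DelayIcc.zero]
  · refine hS2.trans ((hz'.unique_segment hp hpq hadd hreg hz hhist ht).trans ?_)
    filter_upwards [embJ_snd (p := p) (T u)] with s hs
    rw [hs, hTz]

lemma IsSolOpL.cocycle (hp : p ≠ ⊤) (hpq : p.toReal.HolderConjugate q)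
    (hadd : ∀ s t ω, θ (s + t) ω = θ t (θ s ω)) (hreg : ω ∈ regularSet θ A B q) {s t : ℝ}
    (hs : 0 ≤ s) (ht : 0 ≤ t) {S₁ S₂ S : SpaceL N p →L[ℝ] SpaceL N p}
    (h₁ : IsSolOpL p θ A B s ω S₁) (h₂ : IsSolOpL p θ A B t (θ s ω) S₂)
    (h : IsSolOpL p θ A B (s + t) ω S) (v : SpaceL N p) : S v = S₂ (S₁ v) := by
  obtain ⟨z₁, hz₁, hf₁, hs₁⟩ := h₁ v
  obtain ⟨z₂, hz₂, hf₂, hs₂⟩ := h₂ (S₁ v)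
  obtain ⟨z, hz, hf, hsn⟩ := h v
  have hsh := hz.shift hadd hs
  have hz_eq : z s = z₁ s := hz.unique hp hpq hadd hreg hz₁ (ae_eq_refl _) hs
  rw [hz_eq, ← hf₁] at hsh
  have hhist : (fun r : DelayIcc => z (s + r)) =ᵐ[delayVol] (S₁ v).snd :=
    (hz.unique_segment hp hpq hadd hreg hz₁ (ae_eq_refl _) hs).trans hs₁.symm
  have hreg' := mem_regularSet_shift hadd hreg s
  refine spaceL_ext ?_ ?_
  · rw [hf, hf₂]
    exact hsh.unique hp hpq hadd hreg' hz₂ hhist ht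
  · refine hsn.trans (EventuallyEq.trans ?_ hs₂.symm)
    simpa only [add_assoc] using hsh.unique_segment hp hpq hadd hreg' hz₂ hhist ht

/-- After one delay interval the segments of a solution are continuous, so the solution operator on
`L` factors through `J`; the factor is bounded by the closed graph theorem. -/
lemma IsSolOpL.exists_isSolOpLC {t : ℝ} (ht : 1 ≤ t) {S : SpaceL N p →L[ℝ] SpaceL N p}
    (hS : IsSolOpL p θ A B t ω S) :
    ∃ T : SpaceL N p →L[ℝ] SpaceC N, IsSolOpLC p θ A B t ω T := by
  have hex : ∀ v : SpaceL N p, ∃ w : SpaceC N, embJ N p w = S v ∧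
      ∃ z : ℝ → EucN N, IsDelaySolution θ A B ω v.fst v.snd z ∧ ∀ s : DelayIcc, w s = z (t + s) := by
    intro v
    obtain ⟨z, hz, hf, hs⟩ := hS v
    have hcont : Continuous fun s : DelayIcc => z (t + s) :=
      hz.continuousOn.comp_continuous (by fun_prop) fun s => by
        have := s.2.1
        simp only [Set.mem_Ici]; linarith
    refine ⟨⟨_, hcont⟩, spaceL_ext ?_ ((embJ_snd _).trans hs.symm), z, hz, fun s => rfl⟩
    rw [embJ_fst, hf]
    simp [DelayIcc.zero]
  choose w hw hsol using hex
  let T : SpaceL N p →ₗ[ℝ] SpaceC N :=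
    { toFun := w
      map_add' := fun u v => embJ_injective (p := p) (by simp only [map_add, hw])
      map_smul' := fun c v => embJ_injective (p := p) (by
        simp only [map_smul, hw, RingHom.id_apply]) }
  refine ⟨ContinuousLinearMap.ofSeqClosedGraph (g := T) fun u x y hu hy => ?_, hsol⟩
  refine embJ_injective (p := p) ?_
  have h1 : Tendsto (fun n => S (u n)) atTop (𝓝 (S x)) := (S.continuous.tendsto x).comp hu
  have h2 : Tendsto (fun n => embJ N p (w (u n))) atTop (𝓝 (embJ N p y)) :=
    ((embJ N p).continuous.tendsto y).comp hy
  simp only [hw] at h2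
  exact (tendsto_nhds_unique h2 h1).trans (hw x).symm

lemma IsSolOpLC.embJ_apply (hp : p ≠ ⊤) (hpq : p.toReal.HolderConjugate q)
    (hadd : ∀ s t ω, θ (s + t) ω = θ t (θ s ω)) (hreg : ω ∈ regularSet θ A B q) {t : ℝ}
    (ht : 0 ≤ t) {T : SpaceL N p →L[ℝ] SpaceC N} {S : SpaceL N p →L[ℝ] SpaceL N p}
    (hT : IsSolOpLC p θ A B t ω T) (hS : IsSolOpL p θ A B t ω S) (v : SpaceL N p) :
    embJ N p (T v) = S v := by
  obtain ⟨z, hz, hTz⟩ := hT v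
  obtain ⟨z', hz', hS1, hS2⟩ := hS v
  refine spaceL_ext ?_ (((embJ_snd _).trans (EventuallyEq.trans ?_
    (hz.unique_segment hp hpq hadd hreg hz' (ae_eq_refl _) ht))).trans hS2.symm)
  · rw [embJ_fst, hTz, hS1, ← hz.unique hp hpq hadd hreg hz' (ae_eq_refl _) ht]
    simp [DelayIcc.zero]
  · exact Eventually.of_forall hTz

/-- The smoothing estimate: one further unit of time controls the supremum norm of the solution by
its norm in `L`, with a constant depending only on bounds for the integrals of the coefficients. -/
lemma norm_isSolOpC_le (hp : p ≠ ⊤) (hpq : p.toReal.HolderConjugate q)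
    (hadd : ∀ s t ω, θ (s + t) ω = θ t (θ s ω)) (hreg : ω ∈ regularSet θ A B q) {s : ℝ}
    (hs : 0 ≤ s) {T : SpaceC N →L[ℝ] SpaceC N} {S : SpaceL N p →L[ℝ] SpaceL N p}
    (hT : IsSolOpC θ A B (s + 1) ω T) (hS : IsSolOpL p θ A B s ω S) {M : ℝ} {n : ℕ}
    (hn : M ≤ (n + 1) / 2)
    (hA : ∫ r in (0 : ℝ)..1, ‖matOp (A (θ r (θ s ω)))‖ ≤ M)
    (hB : ∫ r in (0 : ℝ)..1, ‖matOp (B (θ r (θ s ω)))‖ ^ q ≤ M) (u : SpaceC N) :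
    ‖T u‖ ≤ 2 ^ (n + 1) * (1 + M ^ (1 / q)) * ‖S (embJ N p u)‖ := by
  obtain ⟨z, hz, hTz⟩ := hT u
  obtain ⟨z', hz', hS1, hS2⟩ := hS (embJ N p u)
  rw [embJ_fst] at hz'
  have hhist := (embJ_snd (p := p) u).symm
  have hB0 : 0 ≤ ∫ r in (0 : ℝ)..1, ‖matOp (B (θ r (θ s ω)))‖ ^ q :=
    intervalIntegral.integral_nonneg zero_le_one fun r _ => by positivity
  have hM : 0 ≤ M := hB0.trans hB
  have hMq : 0 ≤ M ^ (1 / q) := by positivity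
  have hBq : (∫ r in (0 : ℝ)..1, ‖matOp (B (θ r (θ s ω)))‖ ^ q) ^ (1 / q) ≤ M ^ (1 / q) :=
    Real.rpow_le_rpow hB0 hB (one_div_nonneg.2 hpq.symm.nonneg)
  refine (ContinuousMap.norm_le _ (by positivity)).2 fun r => ?_
  have hsegm : (fun r : DelayIcc => z (s + r)) =ᵐ[delayVol] (S (embJ N p u)).snd :=
    (hz.unique_segment hp hpq hadd hreg hz' hhist hs).trans hS2.symm
  have hr : 1 + (r : ℝ) ∈ Set.Icc (0 : ℝ) 1 :=
    ⟨by linarith [r.2.1], by linarith [r.2.2]⟩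
  have h := (hz.shift hadd hs).norm_le hp hpq (mem_regularSet_shift hadd hreg s)
    (S (embJ N p u)).snd hsegm n (hA.trans hn) hr
  rw [hz.unique hp hpq hadd hreg hz' hhist hs, ← hS1, ← add_assoc] at h
  rw [hTz, mul_assoc, WithLp.prod_norm_eq_of_L1]
  refine h.trans (mul_le_mul_of_nonneg_left ?_ (by positivity))
  nlinarith [norm_nonneg (S (embJ N p u)).fst, norm_nonneg (S (embJ N p u)).snd,
    mul_nonneg hMq (norm_nonneg (S (embJ N p u)).fst),
    mul_le_mul_of_nonneg_right hBq (norm_nonneg (S (embJ N p u)).snd)]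

end SolutionOperators

/-! ### The reset coefficients -/

section Reset

variable {Ω : Type*} {N : ℕ} {θ : ℝ → Ω → Ω} {A B : Ω → Matrix (Fin N) (Fin N) ℝ} {q : ℝ}

lemma mem_regularSet_iff (hzero : ∀ ω, θ 0 ω = ω) (hadd : ∀ s t ω, θ (s + t) ω = θ t (θ s ω))
    {ω : Ω} (s : ℝ) : θ s ω ∈ regularSet θ A B q ↔ ω ∈ regularSet θ A B q := by
  refine ⟨fun h => ?_, fun h => mem_regularSet_shift hadd h s⟩
  have := mem_regularSet_shift hadd h (-s)
  rwa [← hadd, add_neg_cancel, hzero] at this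

lemma resetCoeff_of_mem (hzero : ∀ ω, θ 0 ω = ω) (hadd : ∀ s t ω, θ (s + t) ω = θ t (θ s ω))
    {ω : Ω} (h : ω ∈ regularSet θ A B q) (M : Ω → Matrix (Fin N) (Fin N) ℝ) (s : ℝ) :
    resetCoeff (regularSet θ A B q) M (θ s ω) = M (θ s ω) :=
  if_pos ((mem_regularSet_iff hzero hadd s).2 h)

lemma resetCoeff_of_notMem (hzero : ∀ ω, θ 0 ω = ω)
    (hadd : ∀ s t ω, θ (s + t) ω = θ t (θ s ω)) {ω : Ω} (h : ω ∉ regularSet θ A B q)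
    (M : Ω → Matrix (Fin N) (Fin N) ℝ) (s : ℝ) :
    resetCoeff (regularSet θ A B q) M (θ s ω) = 0 :=
  if_neg (mt (mem_regularSet_iff hzero hadd s).1 h)

lemma mem_regularSet_resetCoeff (hzero : ∀ ω, θ 0 ω = ω)
    (hadd : ∀ s t ω, θ (s + t) ω = θ t (θ s ω)) (hq : 0 < q) (ω : Ω) :
    ω ∈ regularSet θ (resetCoeff (regularSet θ A B q) A) (resetCoeff (regularSet θ A B q) B) q := by
  by_cases h : ω ∈ regularSet θ A B q
  · constructor
    · simpa only [resetCoeff_of_mem hzero hadd h] using h.1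
    · simpa only [resetCoeff_of_mem hzero hadd h] using h.2
  · constructor
    · simp only [resetCoeff_of_notMem hzero hadd h, map_zero, norm_zero]
      exact locallyIntegrable_zero
    · simp only [resetCoeff_of_notMem hzero hadd h, map_zero, norm_zero, Real.zero_rpow hq.ne']
      exact locallyIntegrable_zero

/-- The integrals of `‖A‖` and `‖B‖ ^ q` over `[s, s + 1]` along the orbit of `ω` remain bounded
along some sequence `s → ∞`. -/
def IsRecurrent (θ : ℝ → Ω → Ω) (A B : Ω → Matrix (Fin N) (Fin N) ℝ) (q : ℝ) (ω : Ω) : Prop :=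
  ∃ M : ℝ, ∃ᶠ s : ℝ in atTop,
    ∫ r in (0 : ℝ)..1, ‖matOp (A (θ r (θ s ω)))‖ ≤ M ∧
    ∫ r in (0 : ℝ)..1, ‖matOp (B (θ r (θ s ω)))‖ ^ q ≤ M

lemma IsRecurrent.shift (hadd : ∀ s t ω, θ (s + t) ω = θ t (θ s ω)) {ω : Ω}
    (h : IsRecurrent θ A B q ω) (t : ℝ) : IsRecurrent θ A B q (θ t ω) := by
  obtain ⟨M, hM⟩ := h
  refine ⟨M, (tendsto_atTop_add_const_right atTop (-t) tendsto_id).frequently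
    (hM.mono fun s hs => ?_)⟩
  simpa only [id, ← hadd, add_neg_cancel_comm_assoc, add_left_comm, add_comm, add_neg_cancel,
    zero_add, add_zero] using hs

variable [MeasurableSpace Ω] {P : Measure Ω}

lemma measurable_norm_matOp {α : Type*} [MeasurableSpace α] {M : α → Matrix (Fin N) (Fin N) ℝ}
    (hM : ∀ i j, Measurable fun x => M x i j) : Measurable fun x => ‖matOp (M x)‖ := by
  have hc : Continuous fun m : Fin N → Fin N → ℝ => ‖matOp (Matrix.of m)‖ := by
    have : Continuous fun m : Matrix (Fin N) (Fin N) ℝ => matOp m :=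
      (Matrix.toEuclideanCLM (n := Fin N)
        (𝕜 := ℝ)).toAlgEquiv.toLinearMap.continuous_of_finiteDimensional
    exact this.norm
  exact hc.measurable.comp (measurable_pi_iff.2 fun i => measurable_pi_iff.2 fun j => hM i j)

/-- Poincaré recurrence for `θ_1`: a.e. orbit returns infinitely often to a set on which the
integrals of the coefficients are bounded. -/
lemma ae_isRecurrent [IsProbabilityMeasure P] (hθ : IsErgodicMDS P θ) (hS1 : CondS1 A B) (q : ℝ) :
    ∀ᵐ ω ∂P, IsRecurrent θ A B q ω := by
  have hswap : Measurable fun x : Ω × ℝ => θ x.2 x.1 := hθ.measurable.comp measurable_swap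
  have hA : Measurable fun ω => ∫ r in (0 : ℝ)..1, ‖matOp (A (θ r ω))‖ := by
    simp only [intervalIntegral.integral_of_le zero_le_one]
    exact (StronglyMeasurable.integral_prod_right' (f := fun x : Ω × ℝ => ‖matOp (A (θ x.2 x.1))‖)
      (measurable_norm_matOp fun i j =>
        (hS1.measurable_A i j).comp hswap).stronglyMeasurable).measurable
  have hB : Measurable fun ω => ∫ r in (0 : ℝ)..1, ‖matOp (B (θ r ω))‖ ^ q := by
    simp only [intervalIntegral.integral_of_le zero_le_one]
    exact (StronglyMeasurable.integral_prod_right'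
      (f := fun x : Ω × ℝ => ‖matOp (B (θ x.2 x.1))‖ ^ q)
      ((measurable_norm_matOp fun i j =>
        (hS1.measurable_B i j).comp hswap).pow_const q).stronglyMeasurable).measurable
  have hiter : ∀ (n : ℕ) ω, (θ 1)^[n] ω = θ n ω := by
    intro n
    induction n with
    | zero => intro ω; simp [hθ.zero]
    | succ n IH =>
      intro ω
      rw [Function.iterate_succ_apply', IH, ← hθ.add]
      push_cast; rfl
  have hrec : ∀ M : ℕ, ∀ᵐ ω ∂P,
      ω ∈ {ω | ∫ r in (0 : ℝ)..1, ‖matOp (A (θ r ω))‖ ≤ M} ∩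
        {ω | ∫ r in (0 : ℝ)..1, ‖matOp (B (θ r ω))‖ ^ q ≤ M} →
      ∃ᶠ n in atTop, (θ 1)^[n] ω ∈ {ω | ∫ r in (0 : ℝ)..1, ‖matOp (A (θ r ω))‖ ≤ M} ∩
        {ω | ∫ r in (0 : ℝ)..1, ‖matOp (B (θ r ω))‖ ^ q ≤ M} := fun M =>
    (hθ.preserving 1).conservative.ae_mem_imp_frequently_image_mem
      ((measurableSet_le hA measurable_const).inter
        (measurableSet_le hB measurable_const)).nullMeasurableSet
  filter_upwards [ae_all_iff.2 hrec] with ω hω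
  obtain ⟨M, hM⟩ := exists_nat_ge (max (∫ r in (0 : ℝ)..1, ‖matOp (A (θ r ω))‖)
    (∫ r in (0 : ℝ)..1, ‖matOp (B (θ r ω))‖ ^ q))
  refine ⟨M, tendsto_natCast_atTop_atTop.frequently
    ((hω M ⟨(le_max_left _ _).trans hM, (le_max_right _ _).trans hM⟩).mono fun n hn => ?_)⟩
  rw [hiter] at hn
  exact hn

lemma ae_isRecurrent_resetCoeff [IsProbabilityMeasure P] (hθ : IsErgodicMDS P θ)
    (hS1 : CondS1 A B) (hq : 0 < q) :
    ∀ᵐ ω ∂P, IsRecurrent θ (resetCoeff (regularSet θ A B q) A)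
      (resetCoeff (regularSet θ A B q) B) q ω := by
  filter_upwards [ae_isRecurrent hθ hS1 q] with ω hω
  by_cases h : ω ∈ regularSet θ A B q
  · simpa only [IsRecurrent, ← hθ.add, resetCoeff_of_mem hθ.zero hθ.add h] using hω
  · refine ⟨0, Frequently.of_forall fun s => ?_⟩
    simp [← hθ.add, resetCoeff_of_notMem hθ.zero hθ.add h, Real.zero_rpow hq.ne']

end Reset

/-! ### Comparison of the growth rates on `C` and `L` -/

section Comparison

variable {Ω : Type*} {N : ℕ} {θ : ℝ → Ω → Ω} {A B : Ω → Matrix (Fin N) (Fin N) ℝ} {ω : Ω}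
  {p : ENNReal} [Fact (1 ≤ p)] {q : ℝ}

/-- Along a recurrent orbit the growth rates of `u` in `C` and of `J u` in `L` coincide: `J` is
bounded, and the smoothing estimate holds with a fixed constant along some sequence `t → ∞`. -/
lemma rate_eq_rate_embJ (hp : p ≠ ⊤) (hpq : p.toReal.HolderConjugate q)
    (hadd : ∀ s t ω, θ (s + t) ω = θ t (θ s ω)) (hreg : ω ∈ regularSet θ A B q)
    (hrec : IsRecurrent θ A B q ω)
    (hC : ∀ t, 0 ≤ t → IsSolOpC θ A B t ω (semiflowC θ A B t ω))
    (hL : ∀ t, 0 ≤ t → IsSolOpL p θ A B t ω (semiflowL p θ A B t ω))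
    {u : SpaceC N} {a b : EReal} (ha : HasRate (semiflowC θ A B) ω u a)
    (hb : HasRate (semiflowL p θ A B) ω (embJ N p u) b) : a = b := by
  refine le_antisymm ?_ ?_
  · obtain ⟨M, hM⟩ := hrec
    obtain ⟨n, hn⟩ := exists_nat_ge (2 * M)
    have hM0 : 0 ≤ M := by
      obtain ⟨s, hs, -⟩ := hM.exists
      exact (intervalIntegral.integral_nonneg zero_le_one fun r _ => norm_nonneg _).trans hs
    refine rate_le_of_frequently (K := 2 ^ (n + 1) * (1 + M ^ (1 / q))) 1 (by positivity) ha hb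
      ((hM.and_eventually (eventually_ge_atTop 0)).mono ?_)
    rintro s ⟨⟨hA, hB⟩, hs⟩
    exact norm_isSolOpC_le hp hpq hadd hreg hs (hC (s + 1) (by positivity)) (hL s hs)
      (by linarith) hA hB u
  · refine rate_le_of_frequently 0 (norm_nonneg (embJ N p)) hb ha
      ((eventually_ge_atTop 0).mono fun t ht => ?_).frequently
    rw [add_zero, (hL t ht).apply_embJ hp hpq hadd hreg ht (hC t ht)]
    exact (embJ N p).le_opNorm _

lemma rate_semiflowL_eq (hp : p ≠ ⊤) (hpq : p.toReal.HolderConjugate q)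
    (hadd : ∀ s t ω, θ (s + t) ω = θ t (θ s ω)) (hreg : ω ∈ regularSet θ A B q) {t : ℝ}
    (ht : 0 ≤ t) (hL : ∀ s, 0 ≤ s → IsSolOpL p θ A B s ω (semiflowL p θ A B s ω))
    (hL' : ∀ s, 0 ≤ s → IsSolOpL p θ A B s (θ t ω) (semiflowL p θ A B s (θ t ω)))
    {v : SpaceL N p} {a b : EReal} (ha : HasRate (semiflowL p θ A B) ω v a)
    (hb : HasRate (semiflowL p θ A B) (θ t ω) (semiflowL p θ A B t ω v) b) : a = b := by
  have hco : ∀ s, 0 ≤ s → semiflowL p θ A B (s + t) ω v =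
      semiflowL p θ A B s (θ t ω) (semiflowL p θ A B t ω v) := fun s hs => by
    rw [add_comm]
    exact IsSolOpL.cocycle hp hpq hadd hreg ht hs (hL t ht) (hL' s hs) (hL _ (by positivity)) v
  refine le_antisymm ?_ ?_
  · refine rate_le_of_frequently t zero_le_one ha hb
      ((eventually_ge_atTop 0).mono fun s hs => ?_).frequently
    rw [hco s hs, one_mul]
  · refine rate_le_of_frequently (-t) zero_le_one hb ha
      ((eventually_ge_atTop t).mono fun s hs => ?_).frequently
    rw [one_mul, ← hco (s + -t) (by linarith), neg_add_cancel_right]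

variable [MeasurableSpace Ω] {P : Measure Ω}

/-- The orbits over which both decompositions hold and the growth rates can be compared. -/
structure IsComparable (DC : OseledetsDecomposition P θ (semiflowC θ A B))
    (DL : OseledetsDecomposition P θ (semiflowL p θ A B)) (q : ℝ) (ω : Ω) : Prop where
  mem_C : ω ∈ DC.Ω₀
  mem_L : ω ∈ DL.Ω₀
  recurrent : IsRecurrent θ A B q ω
  regular : ω ∈ regularSet θ A B q

namespace IsComparable

variable {DC : OseledetsDecomposition P θ (semiflowC θ A B)}
  {DL : OseledetsDecomposition P θ (semiflowL p θ A B)}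

lemma shift (hadd : ∀ s t ω, θ (s + t) ω = θ t (θ s ω)) (h : IsComparable DC DL q ω) (t : ℝ) :
    IsComparable DC DL q (θ t ω) where
  mem_C := (DC.invariant t).ge h.mem_C
  mem_L := (DL.invariant t).ge h.mem_L
  recurrent := h.recurrent.shift hadd t
  regular := mem_regularSet_shift hadd h.regular t

lemma isSolOpC (h : IsComparable DC DL q ω) (t : ℝ) (ht : 0 ≤ t) :
    IsSolOpC θ A B t ω (semiflowC θ A B t ω) :=
  isSolOpC_semiflowC (DC.semiflow_ne_zero h.mem_C ht)

lemma isSolOpL (h : IsComparable DC DL q ω) (t : ℝ) (ht : 0 ≤ t) :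
    IsSolOpL p θ A B t ω (semiflowL p θ A B t ω) :=
  isSolOpL_semiflowL (DL.semiflow_ne_zero h.mem_L ht)

lemma hasRate_embJ (hp : p ≠ ⊤) (hpq : p.toReal.HolderConjugate q)
    (hadd : ∀ s t ω, θ (s + t) ω = θ t (θ s ω)) (h : IsComparable DC DL q ω) {u : SpaceC N}
    {a : EReal} (ha : HasRate (semiflowC θ A B) ω u a) :
    HasRate (semiflowL p θ A B) ω (embJ N p u) a := by
  obtain ⟨b, hb, -⟩ := DL.exists_hasRate h.mem_L (embJ N p u)
  rwa [rate_eq_rate_embJ hp hpq hadd h.regular h.recurrent h.isSolOpC h.isSolOpL ha hb]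

/-- `U^{(L,C)}_ω(t) v` grows over `θ_t ω` in `C` as `v` grows over `ω` in `L`. -/
lemma hasRate_semiflowLC (hp : p ≠ ⊤) (hpq : p.toReal.HolderConjugate q)
    (hadd : ∀ s t ω, θ (s + t) ω = θ t (θ s ω)) (h : IsComparable DC DL q ω) {t : ℝ} (ht : 1 ≤ t)
    {v : SpaceL N p} {b : EReal} (hb : HasRate (semiflowL p θ A B) ω v b) :
    HasRate (semiflowC θ A B) (θ t ω) (semiflowLC p θ A B t ω v) b := by
  have ht0 : 0 ≤ t := zero_le_one.trans ht
  have h' := h.shift hadd t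
  obtain ⟨a, ha, -⟩ := DC.exists_hasRate h'.mem_C (semiflowLC p θ A B t ω v)
  have hJ := h'.hasRate_embJ hp hpq hadd ha
  have hLC := isSolOpLC_semiflowLC ((h.isSolOpL t ht0).exists_isSolOpLC ht)
  rw [hLC.embJ_apply hp hpq hadd h.regular ht0 (h.isSolOpL t ht0)] at hJ
  rwa [rate_semiflowL_eq hp hpq hadd h.regular ht0 h.isSolOpL h'.isSolOpL hb hJ]

/-- The two semiflows have the same finite rates, so the same Lyapunov exponents. -/
lemma lam_eq (hp : p ≠ ⊤) (hpq : p.toReal.HolderConjugate q)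
    (hadd : ∀ s t ω, θ (s + t) ω = θ t (θ s ω)) (h : IsComparable DC DL q ω) :
    DC.k = DL.k ∧ ∀ i : ℕ, 1 ≤ i → (i : ℕ∞) ≤ DC.k → DC.lam i = DL.lam i := by
  refine eq_of_values_eq DC.lam_strictAnti DL.lam_strictAnti ?_ ?_
  · intro i hi hik
    obtain ⟨u, hu⟩ := DC.exists_hasRate_lam hi hik h.mem_C
    exact DL.eq_lam_of_hasRate h.mem_L (h.hasRate_embJ hp hpq hadd hu)
  · intro i hi hik
    obtain ⟨v, hv⟩ := DL.exists_hasRate_lam hi hik h.mem_L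
    exact DC.eq_lam_of_hasRate (h.shift hadd 1).mem_C
      (h.hasRate_semiflowLC hp hpq hadd le_rfl hv)

end IsComparable

end Comparison

theorem mainTheorem1 {Ω : Type*} [MeasurableSpace Ω] (P : Measure Ω) [IsProbabilityMeasure P]
    [P.IsComplete] (θ : ℝ → Ω → Ω) (hθ : IsErgodicMDS P θ)
    (N : ℕ) (hN : 1 ≤ N) (p : ENNReal) [Fact (1 ≤ p)] (hp1 : 1 < p) (hp : p ≠ ⊤)
    (q : ℝ) (hpq : p.toReal.HolderConjugate q)
    (A B : Ω → Matrix (Fin N) (Fin N) ℝ) (hS1 : CondS1 A B) (hS2 : CondS2 P θ A B q)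
    (A' B' : Ω → Matrix (Fin N) (Fin N) ℝ)
    (hA' : A' = resetCoeff (regularSet θ A B q) A) (hB' : B' = resetCoeff (regularSet θ A B q) B)
    (DC : OseledetsDecomposition P θ (semiflowC θ A' B'))
    (DL : OseledetsDecomposition P θ (semiflowL p θ A' B')) :
    DC.k = DL.k ∧
    (∀ i : ℕ, 1 ≤ i → (i : ℕ∞) ≤ DC.k →
      DC.lam i = DL.lam i ∧
      (∀ᵐ ω ∂P, DC.F i ω = (DL.F i ω).comap (embJ N p).toLinearMap) ∧
      (∀ᵐ ω ∂P, ∀ t : ℝ, 1 ≤ t →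
        (DL.F i ω).map (semiflowLC p θ A' B' t ω).toLinearMap ≤ DC.F i (θ t ω))) ∧
    (∀ᵐ ω ∂P, DC.Finf ω = (DL.Finf ω).comap (embJ N p).toLinearMap) ∧
    (∀ᵐ ω ∂P, ∀ t : ℝ, 1 ≤ t →
      (DL.Finf ω).map (semiflowLC p θ A' B' t ω).toLinearMap ≤ DC.Finf (θ t ω)) := by
  have hadd := hθ.add
  have hgood : ∀ᵐ ω ∂P, IsComparable DC DL q ω := by
    have hC : ∀ᵐ ω ∂P, ω ∈ DC.Ω₀ :=
      mem_ae_iff_prob_eq_one DC.measurableSet |>.2 DC.prob_eq_one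
    have hL : ∀ᵐ ω ∂P, ω ∈ DL.Ω₀ :=
      mem_ae_iff_prob_eq_one DL.measurableSet |>.2 DL.prob_eq_one
    have hrec : ∀ᵐ ω ∂P, IsRecurrent θ A' B' q ω := by
      rw [hA', hB']
      exact ae_isRecurrent_resetCoeff hθ hS1 hpq.symm.pos
    have hreg : ∀ ω, ω ∈ regularSet θ A' B' q := by
      rw [hA', hB']
      exact mem_regularSet_resetCoeff hθ.zero hadd hpq.symm.pos
    filter_upwards [hC, hL, hrec] with ω h1 h2 h3 using ⟨h1, h2, h3, hreg ω⟩
  obtain ⟨ω₀, hω₀⟩ := hgood.exists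
  obtain ⟨hk, hlam⟩ := hω₀.lam_eq hp hpq hadd
  refine ⟨hk, fun i hi hik => ⟨hlam i hi hik, ?_, ?_⟩, ?_, ?_⟩
  · filter_upwards [hgood] with ω hω
    ext u
    obtain ⟨a, ha, -⟩ := DC.exists_hasRate hω.mem_C u
    rw [DC.mem_F_iff hω.mem_C ha hi hik, hlam i hi hik]
    exact (DL.mem_F_iff hω.mem_L (hω.hasRate_embJ hp hpq hadd ha) hi (hk ▸ hik)).symm
  · filter_upwards [hgood] with ω hω t ht
    rintro _ ⟨v, hv, rfl⟩
    obtain ⟨b, hb, -⟩ := DL.exists_hasRate hω.mem_L v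
    refine (DC.mem_F_iff (hω.shift hadd t).mem_C
      (hω.hasRate_semiflowLC hp hpq hadd ht hb) hi hik).2 ?_
    rw [hlam i hi hik]
    exact (DL.mem_F_iff hω.mem_L hb hi (hk ▸ hik)).1 hv
  · filter_upwards [hgood] with ω hω
    ext u
    obtain ⟨a, ha, -⟩ := DC.exists_hasRate hω.mem_C u
    rw [DC.mem_Finf_iff hω.mem_C ha]
    exact (DL.mem_Finf_iff hω.mem_L (hω.hasRate_embJ hp hpq hadd ha)).symm
  · filter_upwards [hgood] with ω hω t ht
    rintro _ ⟨v, hv, rfl⟩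
    obtain ⟨b, hb, -⟩ := DL.exists_hasRate hω.mem_L v
    exact (DC.mem_Finf_iff (hω.shift hadd t).mem_C
      (hω.hasRate_semiflowLC hp hpq hadd ht hb)).2 ((DL.mem_Finf_iff hω.mem_L hb).1 hv)
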